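/- **Chain rule for efficiently learnable functions.** *Learning setting.* Inputs lie on the unit sphere $S=\{x\in\mathbb R^d:\|x\|=1\}$. Fix a slowly decaying kernel $K(x,x')=\sum_{k\ge 0} b_k\,(x\cdot x')^k$, that is, $\sum_k b_k<\infty$ and $b_k\ge c\,(k+1)^{-2}$ for all $k\ge0$ and some $c>0$. The learning algorithm is (ridgeless) kernel least squares regression with $K$: from examples $(x_i,y_i)_{i\le n}$ it outputs $x\mapsto\sum_i\alpha_iK(x_i,x)$ where $\alpha$ solves the least squares problem $H^{T}H\alpha=H^{T}y$ for the Gram matrix $H=(K(x_i,x_j))_{i,j}$; when the labels can be interpolated this is the interpolant of minimal RKHS norm. A loss is a measurable function $\mathcal L(y,\hat y)\in[0,B]$ with $\mathcal L(y,y)=0$ that is $1$-Lipschitz in $\hat y$. For $f:S\to\mathbb R$, a probability distribution $\mathcal D$ on $S$, $\epsilon>0$ and $\delta\in(0,1)$, let $n_{f,\mathcal D}(\epsilon,\delta)$ be the smallest integer $n$ such that, given $n$ i.i.d. examples $(x_i,f(x_i))$ with $x_i\sim\mathcal D$, the algorithm outputs with probability greater than $1-\delta$ a model $\hat f$ with $\mathbb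 E_{x\sim\mathcal D}[\mathcal L(f(x),\hat f(x))]<\epsilon$. For a constant $C>0$, the function $f$ is *efficiently learned* (with respect to $C$) with parameter $M_f$ if $$n_{f,\mathcal D}(\epsilon,\delta)\le C\,\frac{M_f+\log(1/\delta)}{\epsilon^2}\qquad\text{for all }\epsilon>0,\ \delta\in(0,1)\text{ and all }\mathcal D .$$ *Auxiliary functions.* Let $h:S\to\mathbb R$ be given by a multivariate power series $$h(x)=\sum_{k\ge0}\sum_{v\in V_k}a_v\prod_{i=1}^k(\beta_{v,i}\cdot x),\qquad \tilde h(y)=\sum_{k\ge 0}\tilde a_ky^k,\quad \tilde a_k=\sum_{v\in V_k}|a_v|\prod_{i=1}^k\|\beta_{v,i}\|,$$ such that all $\tilde a_k$ are finite and the power series of $\tilde h$ and of $\tilde h'$ converge at $y=1$; $\tilde h'(1)$ denotes the one-sided derivative of $\tilde h$ on $[0,1]$. Let $g$ be analytic around $0$ and equal to its power series $g(y)=\sum_k c_ky^k$ inside its radius of convergence $R_g>0$, and let $\tilde g(y)=\sum_k|c_k|y^k$. *Claim.* For every slowly decaying kernel $K$ and every bound $B$ there is a constant $C>0$, depending only on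 $K$ and $B$ (not on $d$, $g$, $h$ or the loss), such that for every loss $\mathcal L$ as above and all $d,g,h$ as above: if $\tilde h(0)<R_g$ and $\tilde h(1)<R_g$, then $g\circ h$ is efficiently learned with respect to $C$, with parameter $M_{g\circ h}\ge0$ given by $$\sqrt{M_{g\circ h}}=\tilde g'(\tilde h(1))\,\tilde h'(1)+\tilde g(\tilde h(0)).$$ -/

import Mathlib

open MeasureTheory
open scoped ENNReal

noncomputable section

/-- Inputs: the unit sphere of `ℝ^d`. -/
abbrev UnitSphere (d : ℕ) : Type := Metric.sphere (0 : EuclideanSpace ℝ (Fin d)) 1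

section Learning

variable {X : Type*} [MeasurableSpace X]

/-- A learning algorithm maps a finite list of labelled examples to a trained model. -/
abbrev LearningAlgorithm (X : Type*) : Type _ := (n : ℕ) → (Fin n → X) → (Fin n → ℝ) → (X → ℝ)

/-- A loss `L y ŷ` (true value `y`, prediction `ŷ`) with values in `[0, B]`, vanishing on correct
predictions, and `1`-Lipschitz in the prediction. -/
structure IsLoss (B : ℝ) (L : ℝ → ℝ → ℝ) : Prop where
  measurable : Measurable (Function.uncurry L)
  nonneg : ∀ y z, 0 ≤ L y z
  le_bound : ∀ y z, L y z ≤ B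
  self_eq_zero : ∀ y, L y y = 0
  lipschitz : ∀ y, LipschitzWith 1 (L y)

/-- Generalization error `E_{x ∼ D} [L (f x) (fhat x)]`. -/
def generalizationError (L : ℝ → ℝ → ℝ) (D : Measure X) (f fhat : X → ℝ) : ℝ≥0∞ :=
  ∫⁻ x, ENNReal.ofReal (L (f x) (fhat x)) ∂D

/-- Given `n` i.i.d. examples of `f` on `D`, the algorithm produces with probability greater than
`1 - δ` a model of generalization error less than `ε`. (The failure event has outer measure less
than `δ`.) -/
def Succeeds (A : LearningAlgorithm X) (L : ℝ → ℝ → ℝ) (f : X → ℝ) (D : Measure X)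
    (ε δ : ℝ) (n : ℕ) : Prop :=
  (Measure.pi fun _ : Fin n => D)
    {s | ¬ generalizationError L D f (A n s fun i => f (s i)) < ENNReal.ofReal ε}
      < ENNReal.ofReal δ

/-- The smallest number of examples with which the algorithm succeeds (`⊤` if there is none). -/
def sampleComplexity (A : LearningAlgorithm X) (L : ℝ → ℝ → ℝ) (f : X → ℝ) (D : Measure X)
    (ε δ : ℝ) : ℕ∞ :=
  sInf {N : ℕ∞ | ∃ n : ℕ, N = n ∧ Succeeds A L f D ε δ n}

/-- `f` is efficiently learned by `A` with respect to the constant `C`, with complexity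
parameter `M`: for all accuracies, confidences and input distributions, the sample complexity is
at most `C (M + log (1/δ)) / ε²`. -/
def EfficientlyLearnedWith (A : LearningAlgorithm X) (L : ℝ → ℝ → ℝ) (C : ℝ) (f : X → ℝ)
    (M : ℝ) : Prop :=
  ∀ (ε δ : ℝ), 0 < ε → 0 < δ → δ < 1 → ∀ (D : Measure X), IsProbabilityMeasure D →
    (sampleComplexity A L f D ε δ : ℝ≥0∞) ≤
      ENNReal.ofReal (C * (M + Real.log δ⁻¹) / ε ^ 2)

end Learning

section Kernel

/-- The coefficients of a slowly decaying kernel: the series `∑ b_k t^k` converges at `t = 1`, and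
`b_k` is bounded below by a constant times `k⁻²` (by a positive constant for `k = 0`). -/
def SlowlyDecaying (b : ℕ → ℝ) : Prop :=
  Summable b ∧ ∃ c : ℝ, 0 < c ∧ ∀ k : ℕ, c / ((k : ℝ) + 1) ^ 2 ≤ b k

/-- The kernel `K(x, x') = ∑ b_k (x ⬝ x')^k` on the unit sphere. -/
def dotKernel (b : ℕ → ℝ) {d : ℕ} (x x' : UnitSphere d) : ℝ :=
  ∑' k : ℕ, b k * (inner ℝ (x : EuclideanSpace ℝ (Fin d)) x') ^ k

/-- The Gram matrix of a list of points. -/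
def gram {X : Type*} (K : X → X → ℝ) {n : ℕ} (s : Fin n → X) : Matrix (Fin n) (Fin n) ℝ :=
  Matrix.of fun i j => K (s i) (s j)

/-- Every linear least squares problem has a solution (normal equations). -/
theorem exists_normal_eq {n : ℕ} (H : Matrix (Fin n) (Fin n) ℝ) (y : Fin n → ℝ) :
    ∃ α : Fin n → ℝ, (H.transpose * H).mulVec α = H.transpose.mulVec y := by
  have hle : LinearMap.range (H.transpose * H).mulVecLin ≤ LinearMap.range H.transpose.mulVecLin := by
    rw [Matrix.mulVecLin_mul]
    exact LinearMap.range_comp_le_range _ _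
  have hrank : Module.finrank ℝ (LinearMap.range (H.transpose * H).mulVecLin) =
      Module.finrank ℝ (LinearMap.range H.transpose.mulVecLin) := by
    change (H.transpose * H).rank = H.transpose.rank
    rw [Matrix.rank_transpose_mul_self, Matrix.rank_transpose]
  have heq := Submodule.eq_of_le_of_finrank_eq hle hrank
  have hy : H.transpose.mulVec y ∈ LinearMap.range (H.transpose * H).mulVecLin := by
    rw [heq]
    exact ⟨y, rfl⟩
  obtain ⟨α, hα⟩ := hy
  exact ⟨α, hα⟩

/-- Kernel (ridgeless) least squares regression. The model is `x ↦ ∑ i, α i * K (s i) x`, where `α`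
solves the least squares problem for the Gram matrix `H`; if labels can be interpolated this
says `H α = y`, so that the model is the interpolant of minimal norm in the reproducing kernel
Hilbert space of `K`. For a positive semidefinite `K` the model does not depend on the choice of
the solution `α`. -/
def kernelRegression {X : Type*} (K : X → X → ℝ) : LearningAlgorithm X := fun _ s y x =>
  ∑ i, (exists_normal_eq (gram K s) y).choose i * K (s i) x

end Kernel

section Auxiliary

/-- A multivariate power series `∑_k ∑_{v ∈ V_k} a_v ∏_{i=1}^k (β_{v,i} ⬝ x)` in `x ∈ ℝ^d`. -/
structure MultiSeries (d : ℕ) where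
  V : ℕ → Type
  a : (k : ℕ) → V k → ℝ
  β : (k : ℕ) → V k → Fin k → EuclideanSpace ℝ (Fin d)

namespace MultiSeries

variable {d : ℕ} (P : MultiSeries d)

/-- The absolute value bound `|a_v| ∏_i ‖β_{v,i}‖` of a term. -/
def weight (k : ℕ) (v : P.V k) : ℝ := |P.a k v| * ∏ i, ‖P.β k v i‖

/-- The coefficient `∑_{v ∈ V_k} |a_v| ∏_i ‖β_{v,i}‖` of the auxiliary function. -/
def auxCoeff (k : ℕ) : ℝ := ∑' v, P.weight k v

/-- The auxiliary function of the series. -/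
def aux (y : ℝ) : ℝ := ∑' k, P.auxCoeff k * y ^ k

/-- The power series of the auxiliary function and of its derivative converge at `y = 1`. -/
structure ConvergesAtOne : Prop where
  weight : ∀ k, Summable (P.weight k)
  aux : Summable P.auxCoeff
  aux_deriv : Summable fun k : ℕ => (k : ℝ) * P.auxCoeff k

/-- The function `h` on the unit sphere is given by the series. -/
def Represents (h : UnitSphere d → ℝ) : Prop :=
  ∀ x, h x = ∑' k, ∑' v, P.a k v * ∏ i, inner ℝ (P.β k v i) (x : EuclideanSpace ℝ (Fin d))

end MultiSeries

/-- The auxiliary function `∑ |a_k| y^k` of a univariate power series `∑ a_k y^k`. -/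
def univariateAux (p : FormalMultilinearSeries ℝ ℝ ℝ) (y : ℝ) : ℝ :=
  ∑' k, |p.coeff k| * y ^ k

end Auxiliary

end

/-! The number √M controls the RKHS norm of `g ∘ h`, and kernel regression learns a function of RKHS
norm R from about (R² + log (1/δ)) / ε² examples. No RKHS is constructed: `InKernelBall` tests the
norm on finite combinations of point evaluations.

Norm bound. Since (x·y)^k is an inner product of tensor powers, Cauchy–Schwarz gives a monomial of
degree k and weight w norm at most w / √b_k ≤ w (k+1) / √c (`SlowlyDecaying.inKernelBall_monomial`).
Hence an expansion has norm at most (A' + A) / √c, with A the total weight and A' the total of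
weight times degree. Under products, powers and sums these behave like a value and a derivative at
1, so `g ∘ h` has A = g̃(h̃(1)) and A' = g̃'(h̃(1)) h̃'(1). A mean value estimate gives A ≤
g̃(h̃(0)) + A', whence A + A' ≤ 2√M.

Learning. Regression interpolates without leaving the ball (`InKernelBall.kernelRegression`), so the
error f − f̂ lies in the doubled ball and vanishes on the sample. Symmetrization, contraction and
cancellation of random signs bound the expected uniform deviation over a ball
(`integral_ciSup_deviation_le`), and McDiarmid's inequality makes this a high-probability bound
(`measure_exists_vanishing_le`). The loss is dominated by a truncation of |f − f̂|. -/

/-! ### McDiarmid's inequality -/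

section BoundedDifferences

variable {X : Type*} [MeasurableSpace X]

theorem measurable_fin_cons {n : ℕ} :
    Measurable fun q : X × (Fin n → X) => (Fin.cons q.1 q.2 : Fin (n + 1) → X) := by
  refine measurable_pi_lambda _ fun j => ?_
  refine Fin.cases ?_ (fun j => ?_) j
  · simpa using measurable_fst
  · exact (measurable_pi_apply j).comp measurable_snd

theorem integral_pi_fin_succ_eq_prod (D : Measure X) [SigmaFinite D] {n : ℕ}
    (F : (Fin (n + 1) → X) → ℝ) :
    ∫ s, F s ∂(Measure.pi fun _ => D) =
      ∫ q : X × (Fin n → X), F (Fin.cons q.1 q.2) ∂(D.prod (Measure.pi fun _ => D)) := by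
  rw [← ((measurePreserving_piFinSuccAbove (fun _ : Fin (n + 1) => D) 0).symm).integral_comp']
  simp only [MeasurableEquiv.piFinSuccAbove_symm_apply, Fin.insertNthEquiv,
    Equiv.coe_fn_mk, Fin.insertNth_zero']

theorem integrable_of_abs_le {Y : Type*} [MeasurableSpace Y] {μ : Measure Y} [IsFiniteMeasure μ]
    {F : Y → ℝ} (hF : Measurable F) {A : ℝ} (hA : ∀ y, |F y| ≤ A) : Integrable F μ :=
  Integrable.of_bound hF.aestronglyMeasurable A (Filter.Eventually.of_forall hA)

theorem abs_integral_le_of_abs_le {Y : Type*} [MeasurableSpace Y] {μ : Measure Y}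
    [IsProbabilityMeasure μ] {F : Y → ℝ} {A : ℝ} (hA : ∀ y, |F y| ≤ A) : |∫ y, F y ∂μ| ≤ A := by
  simpa using norm_integral_le_of_norm_le_const (μ := μ) (Filter.Eventually.of_forall fun y => (Real.norm_eq_abs _).trans_le (hA y))

/-- Hoeffding's lemma: oscillation at most c confines F to the interval of length c above its
infimum. -/
theorem integral_exp_sub_integral_le {D : Measure X} [IsProbabilityMeasure D] {F : X → ℝ}
    (hF : Measurable F) {A : ℝ} (hA : ∀ x, |F x| ≤ A) {c : ℝ} (hc : 0 ≤ c)
    (hd : ∀ x y, F x - F y ≤ c) (t : ℝ) :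
    ∫ x, Real.exp (t * (F x - ∫ y, F y ∂D)) ∂D ≤ Real.exp (c ^ 2 * t ^ 2 / 8) := by
  have : Nonempty X := nonempty_of_isProbabilityMeasure D
  have hbdd : BddBelow (Set.range F) := ⟨-A, by rintro _ ⟨x, rfl⟩; exact (abs_le.1 (hA x)).1⟩
  have hmem : ∀ x, F x ∈ Set.Icc (⨅ y, F y) ((⨅ y, F y) + c) := fun x =>
    ⟨ciInf_le hbdd x, by
      have : F x - c ≤ ⨅ y, F y := le_ciInf fun y => by linarith [hd x y]
      linarith⟩
  have h := (ProbabilityTheory.hasSubgaussianMGF_of_mem_Icc (μ := D) hF.aemeasurable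
    (Filter.Eventually.of_forall hmem)).mgf_le t
  refine h.trans_eq ?_
  congr 1
  simp [abs_of_nonneg hc]
  ring

/-- The exponential moment bound behind McDiarmid's inequality. -/
theorem integral_exp_le_of_bounded_differences {D : Measure X} [IsProbabilityMeasure D] {A c : ℝ}
    (hc : 0 ≤ c) (t : ℝ) {n : ℕ} (F : (Fin n → X) → ℝ) (hF : Measurable F)
    (hA : ∀ s, |F s| ≤ A) (hd : ∀ s j x, |F (Function.update s j x) - F s| ≤ c) :
    ∫ s, Real.exp (t * (F s - ∫ r, F r ∂(Measure.pi fun _ => D))) ∂(Measure.pi fun _ => D)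
      ≤ Real.exp (n * (c ^ 2 * t ^ 2 / 8)) := by
  induction n with
  | zero =>
    have hconst : ∀ s, F s = F finZeroElim := fun s => congrArg F (Subsingleton.elim _ _)
    simp [hconst]
  | succ n ih =>
    set P : Measure (Fin n → X) := Measure.pi fun _ => D with hP
    set m := ∫ r, F r ∂(Measure.pi fun _ => D) with hm
    have hFc : Measurable fun q : X × (Fin n → X) => F (Fin.cons q.1 q.2) :=
      hF.comp measurable_fin_cons
    have hFi : Integrable (fun q : X × (Fin n → X) => F (Fin.cons q.1 q.2)) (D.prod P) :=
      integrable_of_abs_le hFc fun q => hA _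
    -- Averaging out the first coordinate keeps the mean and the bounded differences, so induction
    -- applies to `G`. The fluctuation of F around `G`, at fixed other coordinates, falls to
    -- Hoeffding's lemma.
    set G : (Fin n → X) → ℝ := fun s => ∫ x, F (Fin.cons x s) ∂D with hG
    have hGm : Measurable G :=
      (hFc.stronglyMeasurable.integral_prod_left' (μ := D)).measurable
    have hGA : ∀ s, |G s| ≤ A := fun s => abs_integral_le_of_abs_le fun x => hA _
    have hmG : m = ∫ s, G s ∂P := by
      rw [hm, integral_pi_fin_succ_eq_prod, integral_prod_symm _ hFi]
    have hsec : ∀ s, Integrable (fun x => F (Fin.cons x s)) D := fun s =>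
      integrable_of_abs_le (hFc.comp (measurable_id.prodMk measurable_const)) fun x => hA _
    have hGd : ∀ s j x, |G (Function.update s j x) - G s| ≤ c := fun s j x => by
      rw [hG]
      simp only
      rw [← integral_sub (hsec _) (hsec _)]
      refine abs_integral_le_of_abs_le fun y => ?_
      rw [Fin.cons_update]
      exact hd _ _ _
    have hI := ih G hGm hGA hGd
    rw [← hmG] at hI
    have hexpm : Measurable fun q : X × (Fin n → X) => Real.exp (t * (F (Fin.cons q.1 q.2) - m)) :=
      Real.measurable_exp.comp ((hFc.sub_const _).const_mul _)
    have hexpb : ∀ u : ℝ, |u| ≤ A → |Real.exp (t * (u - m))| ≤ Real.exp (|t| * (A + |m|)) := by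
      intro u hu
      rw [abs_of_pos (Real.exp_pos _)]
      refine Real.exp_le_exp.2 ((le_abs_self _).trans ?_)
      rw [abs_mul]
      gcongr
      exact (abs_sub _ _).trans (by gcongr)
    have hexpi : Integrable (fun q : X × (Fin n → X) => Real.exp (t * (F (Fin.cons q.1 q.2) - m)))
        (D.prod P) := integrable_of_abs_le hexpm fun q => hexpb _ (hA _)
    rw [integral_pi_fin_succ_eq_prod, integral_prod_symm _ hexpi]
    calc ∫ s, ∫ x, Real.exp (t * (F (Fin.cons x s) - m)) ∂D ∂P
        ≤ ∫ s, Real.exp (c ^ 2 * t ^ 2 / 8) * Real.exp (t * (G s - m)) ∂P := by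
          refine integral_mono hexpi.integral_prod_right ?_ fun s => ?_
          · refine Integrable.const_mul ?_ _
            exact integrable_of_abs_le (Real.measurable_exp.comp ((hGm.sub_const _).const_mul _))
              fun s => hexpb _ (hGA s)
          · have h1 := integral_exp_sub_integral_le (D := D) (F := fun x => F (Fin.cons x s))
              (hFc.comp (measurable_id.prodMk measurable_const)) (fun x => hA _) hc
              (fun x y => by
                have := hd (Fin.cons y s) 0 x
                rw [Fin.update_cons_zero] at this
                exact (le_abs_self _).trans this) t
            have h2 : ∀ x, Real.exp (t * (F (Fin.cons x s) - m)) =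
                Real.exp (t * (F (Fin.cons x s) - G s)) * Real.exp (t * (G s - m)) := fun x => by
              rw [← Real.exp_add]; congr 1; ring
            simp only [h2]
            rw [integral_mul_const]
            exact mul_le_mul_of_nonneg_right h1 (Real.exp_pos _).le
      _ ≤ Real.exp (c ^ 2 * t ^ 2 / 8) * Real.exp (n * (c ^ 2 * t ^ 2 / 8)) := by
          rw [integral_const_mul]
          exact mul_le_mul_of_nonneg_left hI (Real.exp_pos _).le
      _ = _ := by
          rw [← Real.exp_add]; congr 1; push_cast; ring

/-- **McDiarmid's inequality** for identically distributed samples. -/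
theorem measure_ge_le_of_bounded_differences {D : Measure X} [IsProbabilityMeasure D] {A c : ℝ}
    (hc : 0 < c) {n : ℕ} (hn : 0 < n) (F : (Fin n → X) → ℝ) (hF : Measurable F)
    (hA : ∀ s, |F s| ≤ A) (hd : ∀ s j x, |F (Function.update s j x) - F s| ≤ c)
    {r : ℝ} (hr : 0 ≤ r) :
    (Measure.pi fun _ : Fin n => D).real
        {s | ∫ q, F q ∂(Measure.pi fun _ => D) + r ≤ F s}
      ≤ Real.exp (-(2 * r ^ 2 / (n * c ^ 2))) := by
  set P : Measure (Fin n → X) := Measure.pi fun _ => D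
  set m := ∫ q, F q ∂P with hm
  have hn' : (0 : ℝ) < n := Nat.cast_pos.2 hn
  -- The minimizer of −t r + n c² t² / 8 in the Chernoff bound.
  set t : ℝ := 4 * r / (n * c ^ 2) with ht
  have ht0 : 0 ≤ t := by positivity
  have hexpi : Integrable (fun s => Real.exp (t * (F s - m))) P := by
    refine integrable_of_abs_le (A := Real.exp (|t| * (A + |m|)))
      (Real.measurable_exp.comp ((hF.sub_const _).const_mul _)) fun s => ?_
    rw [abs_of_pos (Real.exp_pos _)]
    refine Real.exp_le_exp.2 ((le_abs_self _).trans ?_)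
    rw [abs_mul]
    gcongr
    exact (abs_sub _ _).trans (by gcongr; exact hA s)
  have h1 := ProbabilityTheory.measure_ge_le_exp_mul_mgf (μ := P) (X := fun s => F s - m) r ht0 hexpi
  have h2 := integral_exp_le_of_bounded_differences (D := D) hc.le t F hF hA hd
  have hset : {s | m + r ≤ F s} = {s | r ≤ F s - m} := by
    ext s; simp only [Set.mem_ofPred_eq]; constructor <;> intro h <;> linarith
  rw [hset]
  refine h1.trans ?_
  refine (mul_le_mul_of_nonneg_left h2 (Real.exp_pos _).le).trans_eq ?_
  rw [← Real.exp_add]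
  congr 1
  rw [ht]
  field_simp
  ring

end BoundedDifferences

/-! ### Symmetrization and contraction, one sample at a time -/

section Peeling

theorem abs_ciSup_le_of_abs_le {ι : Type*} [Nonempty ι] {f : ι → ℝ} {A : ℝ}
    (h : ∀ i, |f i| ≤ A) : |⨆ i, f i| ≤ A := by
  have hb : BddAbove (Set.range f) := ⟨A, by rintro _ ⟨i, rfl⟩; exact (abs_le.1 (h i)).2⟩
  obtain ⟨i⟩ := ‹Nonempty ι›
  exact abs_le.2 ⟨(abs_le.1 (h i)).1.trans (le_ciSup hb i), ciSup_le fun i => (abs_le.1 (h i)).2⟩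

theorem bddAbove_range_of_abs_le {ι : Type*} {f : ι → ℝ} {A : ℝ}
    (h : ∀ i, |f i| ≤ A) : BddAbove (Set.range f) :=
  ⟨A, by rintro _ ⟨i, rfl⟩; exact (abs_le.1 (h i)).2⟩

/-- The index set may be uncountable; a supremum of continuous functions is still lower
semicontinuous. -/
theorem measurable_ciSup_of_continuous {ι : Type*} {Y : Type*} [TopologicalSpace Y] [MeasurableSpace Y]
    [OpensMeasurableSpace Y] {f : ι → Y → ℝ} (hf : ∀ i, Continuous (f i)) {A : ℝ}
    (hA : ∀ i y, |f i y| ≤ A) : Measurable fun y => ⨆ i, f i y :=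
  (lowerSemicontinuous_ciSup (fun y => bddAbove_range_of_abs_le fun i => hA i y)
    fun i => (hf i).lowerSemicontinuous).measurable

variable {ι : Type*} [Nonempty ι]

theorem integrable_ciSup_of_continuous {Y : Type*} [TopologicalSpace Y] [MeasurableSpace Y]
    [OpensMeasurableSpace Y] {μ : Measure Y} [IsFiniteMeasure μ] {f : ι → Y → ℝ}
    (hf : ∀ i, Continuous (f i)) {A : ℝ}
    (hA : ∀ i y, |f i y| ≤ A) : Integrable (fun y => ⨆ i, f i y) μ :=
  integrable_of_abs_le (measurable_ciSup_of_continuous hf hA) fun y =>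
    abs_ciSup_le_of_abs_le fun i => hA i y

theorem abs_add_sum_le {X : Type*} {n : ℕ} {a A : ℝ} {w : X → ℝ} (h : ∀ x, |w x| ≤ A) {c : ℝ}
    (ha : |a| ≤ c) (s : Fin n → X) : |a + ∑ j, w (s j)| ≤ c + n * A := by
  refine (abs_add_le _ _).trans (add_le_add ha ((Finset.abs_sum_le_sum_abs _ _).trans ?_))
  refine (Finset.sum_le_card_nsmul _ _ A fun j _ => h _).trans_eq ?_
  simp

variable {X Z : Type*} [TopologicalSpace X] [SecondCountableTopology X] [MeasurableSpace X]
  [BorelSpace X] [TopologicalSpace Z] [SecondCountableTopology Z] [MeasurableSpace Z] [BorelSpace Z]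

/-- If replacing one sample of `D` by one sample of `ρ` increases the expected supremum whatever
the offsets, then so does replacing `n` independent samples. -/
theorem integral_ciSup_sum_le_of_step {D : Measure X} [IsProbabilityMeasure D] {ρ : Measure Z}
    [IsProbabilityMeasure ρ] {G : ι → X → ℝ} {V : ι → Z → ℝ} (hG : ∀ i, Continuous (G i))
    (hV : ∀ i, Continuous (V i)) {A : ℝ} (hGA : ∀ i x, |G i x| ≤ A) (hVA : ∀ i z, |V i z| ≤ A)
    (hstep : ∀ (a : ι → ℝ) (c : ℝ), (∀ i, |a i| ≤ c) →
      ∫ x, ⨆ i, (a i + G i x) ∂D ≤ ∫ z, ⨆ i, (a i + V i z) ∂ρ)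
    (n : ℕ) (a : ι → ℝ) (c : ℝ) (ha : ∀ i, |a i| ≤ c) :
    ∫ s : Fin n → X, ⨆ i, (a i + ∑ j, G i (s j)) ∂(Measure.pi fun _ => D) ≤
      ∫ s : Fin n → Z, ⨆ i, (a i + ∑ j, V i (s j)) ∂(Measure.pi fun _ => ρ) := by
  induction n generalizing a c with
  | zero => simp
  | succ n ih =>
    set P : Measure (Fin n → X) := Measure.pi fun _ => D with hP
    set Q : Measure (Fin n → Z) := Measure.pi fun _ => ρ with hQ
    rw [integral_pi_fin_succ_eq_prod, integral_pi_fin_succ_eq_prod]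
    simp only [Fin.sum_univ_succ, Fin.cons_zero, Fin.cons_succ]
    have hcG : ∀ i, Continuous fun s : Fin n → X => ∑ j, G i (s j) := fun i =>
      continuous_finsetSum _ fun j _ => (hG i).comp (continuous_apply j)
    have hcV : ∀ i, Continuous fun s : Fin n → Z => ∑ j, V i (s j) := fun i =>
      continuous_finsetSum _ fun j _ => (hV i).comp (continuous_apply j)
    have haV : ∀ i z, |a i + V i z| ≤ c + A := fun i z =>
      (abs_add_le _ _).trans (add_le_add (ha i) (hVA i z))
    have haG : ∀ i x, |a i + G i x| ≤ c + A := fun i x =>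
      (abs_add_le _ _).trans (add_le_add (ha i) (hGA i x))
    have i1 : Integrable (fun q : X × (Fin n → X) => ⨆ i, (a i + (G i q.1 + ∑ j, G i (q.2 j))))
        (D.prod P) := by
      refine integrable_ciSup_of_continuous (A := c + A + n * A) (fun i => ?_) fun i q => ?_
      · exact continuous_const.add (((hG i).comp continuous_fst).add ((hcG i).comp continuous_snd))
      · rw [← add_assoc]; exact abs_add_sum_le (hGA i) (haG i _) _
    have i2 : Integrable (fun q : Z × (Fin n → X) => ⨆ i, (a i + (V i q.1 + ∑ j, G i (q.2 j))))
        (ρ.prod P) := by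
      refine integrable_ciSup_of_continuous (A := c + A + n * A) (fun i => ?_) fun i q => ?_
      · exact continuous_const.add (((hV i).comp continuous_fst).add ((hcG i).comp continuous_snd))
      · rw [← add_assoc]; exact abs_add_sum_le (hGA i) (haV i _) _
    have i3 : Integrable (fun q : Z × (Fin n → Z) => ⨆ i, (a i + (V i q.1 + ∑ j, V i (q.2 j))))
        (ρ.prod Q) := by
      refine integrable_ciSup_of_continuous (A := c + A + n * A) (fun i => ?_) fun i q => ?_
      · exact continuous_const.add (((hV i).comp continuous_fst).add ((hcV i).comp continuous_snd))
      · rw [← add_assoc]; exact abs_add_sum_le (hVA i) (haV i _) _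
    calc _ = ∫ s, ∫ x, ⨆ i, (a i + (G i x + ∑ j, G i (s j))) ∂D ∂P := integral_prod_symm _ i1
      _ ≤ ∫ s, ∫ z, ⨆ i, (a i + (V i z + ∑ j, G i (s j))) ∂ρ ∂P := by
          refine integral_mono i1.integral_prod_right i2.integral_prod_right fun s => ?_
          -- At fixed other samples, their sum is part of the offset; this is why the step must hold
          -- for all offsets.
          have := hstep (fun i => a i + ∑ j, G i (s j)) (c + n * A)
            fun i => abs_add_sum_le (hGA i) (ha i) s
          simpa only [add_assoc, add_comm (∑ j, G _ (s j))] using this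
      _ = ∫ q : Z × (Fin n → X), ⨆ i, (a i + (V i q.1 + ∑ j, G i (q.2 j))) ∂(ρ.prod P) :=
          (integral_prod_symm _ i2).symm
      _ = ∫ z, ∫ s, ⨆ i, (a i + (V i z + ∑ j, G i (s j))) ∂P ∂ρ := integral_prod _ i2
      _ ≤ ∫ z, ∫ s, ⨆ i, (a i + (V i z + ∑ j, V i (s j))) ∂Q ∂ρ := by
          refine integral_mono i2.integral_prod_left i3.integral_prod_left fun z => ?_
          simpa only [add_assoc] using ih (fun i => a i + V i z) (c + A) fun i => haV i z
      _ = _ := (integral_prod _ i3).symm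

/-- The uniform distribution on two signs. -/
noncomputable def signMeasure : Measure Bool :=
  (2⁻¹ : ℝ≥0∞) • (Measure.dirac true + Measure.dirac false)

/-- The sign encoded by a Boolean. -/
def boolSign (σ : Bool) : ℝ := if σ then 1 else -1

instance : IsProbabilityMeasure signMeasure := ⟨by
  simp only [signMeasure, Measure.smul_apply, Measure.add_apply, measure_univ, smul_eq_mul]
  rw [one_add_one_eq_two]
  exact ENNReal.inv_mul_cancel (by norm_num) (by norm_num)⟩

theorem integral_signMeasure (f : Bool → ℝ) :
    ∫ σ, f σ ∂signMeasure = (f true + f false) / 2 := by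
  rw [signMeasure, integral_smul_measure, integral_add_measure (by simp)
    (by simp)]
  simp
  ring

theorem abs_boolSign (σ : Bool) : |boolSign σ| = 1 := by
  cases σ <;> simp [boolSign]

/-- A sum of two suprema is a supremum over pairs, and p, q may be evaluated at the pair in either
order. This freedom resolves the absolute value in the contraction argument. -/
theorem ciSup_add_ciSup_le_of_swap {f g p q : ι → ℝ} {A : ℝ}
    (hp : ∀ i, |p i| ≤ A) (hq : ∀ i, |q i| ≤ A)
    (h : ∀ i j, f i + g j ≤ p i + q j ∨ f i + g j ≤ p j + q i) :
    (⨆ i, f i) + (⨆ i, g i) ≤ (⨆ i, p i) + ⨆ i, q i := by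
  have key : ∀ i j, f i + g j ≤ (⨆ i, p i) + ⨆ i, q i := fun i j => by
    have hpb := bddAbove_range_of_abs_le hp
    have hqb := bddAbove_range_of_abs_le hq
    rcases h i j with h | h
    · exact h.trans (add_le_add (le_ciSup hpb _) (le_ciSup hqb _))
    · exact h.trans (add_le_add (le_ciSup hpb _) (le_ciSup hqb _))
  have h1 : ∀ i, (⨆ j, g j) ≤ (⨆ i, p i) + (⨆ i, q i) - f i := fun i =>
    ciSup_le fun j => by linarith [key i j]
  have h2 : (⨆ i, f i) ≤ (⨆ i, p i) + (⨆ i, q i) - ⨆ j, g j :=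
    ciSup_le fun i => by linarith [h1 i]
  linarith

/-- Symmetrization and contraction for one sample. -/
theorem integral_ciSup_symmetrize_le {D : Measure X} [IsProbabilityMeasure D] {U : ι → X → ℝ}
    (hU : ∀ i, Continuous (U i)) {A B : ℝ} (hUA : ∀ i x, |U i x| ≤ A) {φ : ℝ → ℝ}
    (hφ : LipschitzWith 1 φ) (hφB : ∀ y, |φ y| ≤ B) (a : ι → ℝ) (c : ℝ) (ha : ∀ i, |a i| ≤ c) :
    ∫ x, ⨆ i, (a i + (∫ y, φ (U i y) ∂D - φ (U i x))) ∂D ≤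
      ∫ z : X × Bool, ⨆ i, (a i + 2 * boolSign z.2 * U i z.1) ∂(D.prod signMeasure) := by
  have hφc := hφ.continuous
  have bp : ∀ i x, |a i + 2 * φ (U i x)| ≤ c + 2 * B := fun i x => by
    refine (abs_add_le _ _).trans (add_le_add (ha i) ?_)
    rw [abs_mul, abs_two]; linarith [hφB (U i x)]
  have bm : ∀ i x, |a i + -2 * φ (U i x)| ≤ c + 2 * B := fun i x => by
    refine (abs_add_le _ _).trans (add_le_add (ha i) ?_)
    rw [abs_mul, abs_neg, abs_two]; linarith [hφB (U i x)]
  have bE : ∀ i, |a i + 2 * ∫ y, φ (U i y) ∂D| ≤ c + 2 * B := fun i => by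
    refine (abs_add_le _ _).trans (add_le_add (ha i) ?_)
    have := abs_integral_le_of_abs_le (μ := D) fun x => hφB (U i x)
    rw [abs_mul, abs_two]; linarith
  have b0 : ∀ i x, |a i + (∫ y, φ (U i y) ∂D - φ (U i x))| ≤ c + 2 * B := fun i x => by
    refine (abs_add_le _ _).trans (add_le_add (ha i) ((abs_sub _ _).trans ?_))
    have := abs_integral_le_of_abs_le (μ := D) fun x => hφB (U i x)
    linarith [hφB (U i x)]
  have bs : ∀ (i : ι) (z : X × Bool), |a i + 2 * boolSign z.2 * U i z.1| ≤ c + 2 * A := by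
    intro i z
    refine (abs_add_le _ _).trans (add_le_add (ha i) ?_)
    rw [abs_mul, abs_mul, abs_boolSign, abs_two]; linarith [hUA i z.1]
  have cφ : ∀ i, Continuous fun x => φ (U i x) := fun i => hφc.comp (hU i)
  have i0 : Integrable (fun x => ⨆ i, (a i + (∫ y, φ (U i y) ∂D - φ (U i x)))) D :=
    integrable_ciSup_of_continuous (fun i => by have := cφ i; fun_prop) b0
  have ip : Integrable (fun x => ⨆ i, (a i + 2 * φ (U i x))) D :=
    integrable_ciSup_of_continuous (fun i => by have := cφ i; fun_prop) bp
  have im : Integrable (fun x => ⨆ i, (a i + -2 * φ (U i x))) D :=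
    integrable_ciSup_of_continuous (fun i => by have := cφ i; fun_prop) bm
  have hsc : Continuous boolSign := continuous_of_discreteTopology
  have is : Integrable (fun z : X × Bool => ⨆ i, (a i + 2 * boolSign z.2 * U i z.1))
      (D.prod signMeasure) :=
    integrable_ciSup_of_continuous (fun i => by have := hU i; fun_prop) bs
  have is1 := is.integral_prod_left
  simp only [integral_signMeasure] at is1
  -- Jensen: the supremum of the means is at most the mean of the supremum.
  have hE : (⨆ i, (a i + 2 * ∫ y, φ (U i y) ∂D)) ≤ ∫ x, ⨆ i, (a i + 2 * φ (U i x)) ∂D := by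
    refine ciSup_le fun i => ?_
    have hi : Integrable (fun x => φ (U i x)) D :=
      integrable_of_abs_le (cφ i).measurable fun x => hφB _
    have : a i + 2 * ∫ y, φ (U i y) ∂D = ∫ x, (a i + 2 * φ (U i x)) ∂D := by
      rw [integral_add (integrable_const _) (hi.const_mul _), integral_const_mul]; simp
    rw [this]
    exact integral_mono ((integrable_const _).add (hi.const_mul _)) ip fun x =>
      le_ciSup (f := fun i => a i + 2 * φ (U i x)) (bddAbove_range_of_abs_le fun i => bp i x) i
  rw [integral_prod _ is]
  simp only [integral_signMeasure]
  -- The integrand's terms are midpoints of a + 2𝔼φ and a − 2φ, so `hE` symmetrizes without a ghost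
  -- sample. The last step replaces φ(U) by U.
  calc ∫ x, ⨆ i, (a i + (∫ y, φ (U i y) ∂D - φ (U i x))) ∂D
      ≤ ∫ x, ((⨆ i, (a i + 2 * ∫ y, φ (U i y) ∂D)) + ⨆ i, (a i + -2 * φ (U i x))) / 2 ∂D := by
        refine integral_mono i0 (((integrable_const _).add im).div_const _) fun x => ?_
        refine ciSup_le fun i => ?_
        have h1 := le_ciSup (bddAbove_range_of_abs_le bE) i
        have h2 := le_ciSup (f := fun i => a i + -2 * φ (U i x))
          (bddAbove_range_of_abs_le fun i => bm i x) i
        linarith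
    _ ≤ ∫ x, ((⨆ i, (a i + 2 * φ (U i x))) + ⨆ i, (a i + -2 * φ (U i x))) / 2 ∂D := by
        rw [integral_div, integral_div, integral_add (integrable_const _) im, integral_add ip im]
        simp only [integral_const, probReal_univ, one_smul]
        linarith
    _ ≤ _ := by
        refine integral_mono ((ip.add im).div_const _) is1 fun x => ?_
        refine div_le_div_of_nonneg_right ?_ zero_le_two
        refine ciSup_add_ciSup_le_of_swap (A := c + 2 * A) (fun i => bs i (x, true))
          (fun i => bs i (x, false)) fun i j => ?_
        have hd := hφ.dist_le_mul (U i x) (U j x)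
        simp only [Real.dist_eq, NNReal.coe_one, one_mul] at hd
        simp only [boolSign, if_true, Bool.false_eq_true, if_false]
        have h := (le_abs_self _).trans hd
        -- The index with the larger value of U takes the plus sign.
        rcases le_total (U i x) (U j x) with hij | hij
        · right; rw [abs_of_nonpos (by linarith)] at h; linarith
        · left; rw [abs_of_nonneg (by linarith)] at h; linarith

end Peeling

/-! ### Balls of the RKHS, described by duality -/

section KernelBall

variable {X : Type*}

/-- The quadratic form of a kernel at finitely many points. -/
def kernelForm (K : X → X → ℝ) {ι : Type*} [Fintype ι] (s : ι → X) (α : ι → ℝ) : ℝ :=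
  ∑ i, ∑ j, α i * α j * K (s i) (s j)

/-- Positive semidefiniteness of a kernel on finite families of points. -/
def IsPosSemidefKernel (K : X → X → ℝ) : Prop :=
  ∀ (ι : Type) [Fintype ι] (s : ι → X) (α : ι → ℝ), 0 ≤ kernelForm K s α

/-- `u` lies in the ball of radius `R` of the reproducing kernel Hilbert space of `K`, expressed by
duality with finite combinations of point evaluations. -/
def InKernelBall (K : X → X → ℝ) (R : ℝ) (u : X → ℝ) : Prop :=
  ∀ (ι : Type) [Fintype ι] (s : ι → X) (α : ι → ℝ),
    |∑ i, α i * u (s i)| ≤ R * √(kernelForm K s α)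

theorem InKernelBall.abs_le {K : X → X → ℝ} {R : ℝ} {u : X → ℝ} (hu : InKernelBall K R u) (x : X) :
    |u x| ≤ R * √(K x x) := by
  simpa [kernelForm] using hu Unit (fun _ => x) fun _ => 1

theorem InKernelBall.abs_sub_le {K : X → X → ℝ} {R : ℝ} {u : X → ℝ} (hu : InKernelBall K R u)
    (x y : X) : |u x - u y| ≤ R * √(K x x - K x y - K y x + K y y) := by
  have h := hu (Fin 2) ![x, y] ![1, -1]
  simp only [kernelForm, Fin.sum_univ_two, Matrix.cons_val_zero, Matrix.cons_val_one] at h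
  ring_nf at h ⊢
  exact h

theorem inKernelBall_zero (K : X → X → ℝ) {R : ℝ} (hR : 0 ≤ R) : InKernelBall K R fun _ => 0 := by
  intro ι _ s α
  simpa using mul_nonneg hR (Real.sqrt_nonneg _)

theorem InKernelBall.sub {K : X → X → ℝ} {R R' : ℝ} {u v : X → ℝ} (hu : InKernelBall K R u)
    (hv : InKernelBall K R' v) : InKernelBall K (R + R') fun x => u x - v x := by
  intro ι _ s α
  simp only [mul_sub, Finset.sum_sub_distrib, add_mul]
  exact (abs_sub _ _).trans (add_le_add (hu ι s α) (hv ι s α))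

theorem InKernelBall.mono {K : X → X → ℝ} {R R' : ℝ} {u : X → ℝ} (hu : InKernelBall K R u)
    (h : R ≤ R') : InKernelBall K R' u := fun ι _ s α =>
  (hu ι s α).trans (mul_le_mul_of_nonneg_right h (Real.sqrt_nonneg _))

/-- The kernel distance from y to x controls |u y − u x| and tends to 0 as y → x. Continuity is what
makes suprema over the ball measurable. -/
theorem InKernelBall.continuous [TopologicalSpace X] {K : X → X → ℝ}
    (hK : Continuous (Function.uncurry K)) {R : ℝ} {u : X → ℝ} (hu : InKernelBall K R u) :
    Continuous u := by
  refine continuous_iff_continuousAt.2 fun x => ?_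
  rw [ContinuousAt, tendsto_iff_dist_tendsto_zero]
  have hK2 : ∀ {f g : X → X}, Continuous f → Continuous g → Continuous fun y => K (f y) (g y) :=
    fun hf hg => hK.comp (hf.prodMk hg)
  have h1 : Continuous fun y => R * √(K y y - K y x - K x y + K x x) := by
    have a := hK2 continuous_id continuous_id
    have b := hK2 continuous_id (continuous_const (y := x))
    have c := hK2 (continuous_const (y := x)) continuous_id
    simp only [id] at a b c
    fun_prop
  have h2 := h1.tendsto x
  simp only [sub_self, sub_add_cancel, Real.sqrt_zero, mul_zero] at h2
  refine squeeze_zero (fun _ => dist_nonneg) (fun y => ?_) h2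
  rw [Real.dist_eq]
  exact hu.abs_sub_le y x

/-! ### Uniform deviations over a kernel ball -/

variable [TopologicalSpace X] [SecondCountableTopology X] [MeasurableSpace X] [BorelSpace X]

omit [SecondCountableTopology X] [MeasurableSpace X] [BorelSpace X] in
theorem continuous_kernelForm_sign {K : X → X → ℝ} (hK : Continuous (Function.uncurry K)) (n : ℕ) :
    Continuous fun z : Fin n → X × Bool =>
      kernelForm K (fun i => (z i).1) fun i => boolSign (z i).2 := by
  have hs : Continuous boolSign := continuous_of_discreteTopology
  refine continuous_finsetSum _ fun i _ => continuous_finsetSum _ fun j _ => ?_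
  have h1 : Continuous fun z : Fin n → X × Bool => K (z i).1 (z j).1 :=
    hK.comp (f := fun z : Fin n → X × Bool => ((z i).1, (z j).1)) (by fun_prop)
  fun_prop

omit [TopologicalSpace X] [SecondCountableTopology X] [MeasurableSpace X] [BorelSpace X] in
theorem abs_kernelForm_sign_le {K : X → X → ℝ} {k : ℝ} (hk : ∀ x y, |K x y| ≤ k) {n : ℕ}
    (z : Fin n → X × Bool) :
    |kernelForm K (fun i => (z i).1) fun i => boolSign (z i).2| ≤ n * (n * k) := by
  refine (Finset.abs_sum_le_sum_abs _ _).trans ?_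
  refine (Finset.sum_le_card_nsmul _ _ (n * k) fun i _ => ?_).trans_eq (by simp)
  refine (Finset.abs_sum_le_sum_abs _ _).trans ?_
  refine (Finset.sum_le_card_nsmul _ _ k fun i _ => ?_).trans_eq (by simp)
  rw [abs_mul, abs_mul, abs_boolSign, abs_boolSign]
  simpa using hk _ _

-- Isolates the new sign: its square is 1 on the diagonal, and the cross terms are linear in it,
-- hence average to zero.
omit [TopologicalSpace X] [SecondCountableTopology X] [MeasurableSpace X] [BorelSpace X] in
theorem kernelForm_sign_cons (K : X → X → ℝ) {n : ℕ} (x : X) (σ : Bool) (z : Fin n → X × Bool) :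
    kernelForm K (fun i => ((Fin.cons (x, σ) z : Fin (n + 1) → X × Bool) i).1)
        (fun i => boolSign ((Fin.cons (x, σ) z : Fin (n + 1) → X × Bool) i).2) =
      K x x + boolSign σ * (∑ j, boolSign (z j).2 * K x (z j).1 +
        ∑ i, boolSign (z i).2 * K (z i).1 x) +
      kernelForm K (fun i => (z i).1) fun i => boolSign (z i).2 := by
  have hσ : boolSign σ * boolSign σ = 1 := by cases σ <;> simp [boolSign]
  simp only [kernelForm, Fin.sum_univ_succ, Fin.cons_zero, Fin.cons_succ,
    Finset.sum_add_distrib, mul_add, Finset.mul_sum, mul_assoc, mul_left_comm _ (boolSign σ)]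
  ring_nf
  rw [pow_two, hσ, one_mul]

/-- Independent signs cancel all off-diagonal terms in expectation, leaving n diagonal ones instead
of n². -/
theorem integral_kernelForm_sign_le {D : Measure X} [IsProbabilityMeasure D] {K : X → X → ℝ}
    (hK : Continuous (Function.uncurry K)) {k : ℝ} (hk : ∀ x y, |K x y| ≤ k) (n : ℕ) :
    ∫ z : Fin n → X × Bool, kernelForm K (fun i => (z i).1) (fun i => boolSign (z i).2)
      ∂(Measure.pi fun _ => D.prod signMeasure) ≤ n * k := by
  induction n with
  | zero => simp [kernelForm]
  | succ n ih =>
    set P : Measure (Fin n → X × Bool) := Measure.pi fun _ => D.prod signMeasure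
    have hi : Integrable (fun z : Fin n → X × Bool =>
        kernelForm K (fun i => (z i).1) fun i => boolSign (z i).2) P :=
      integrable_of_abs_le (continuous_kernelForm_sign hK n).measurable
        (abs_kernelForm_sign_le hk)
    have hi1 : Integrable (fun q : (X × Bool) × (Fin n → X × Bool) =>
        kernelForm K (fun i => ((Fin.cons q.1 q.2 : Fin (n + 1) → X × Bool) i).1)
          fun i => boolSign ((Fin.cons q.1 q.2 : Fin (n + 1) → X × Bool) i).2)
        ((D.prod signMeasure).prod P) :=
      integrable_of_abs_le ((continuous_kernelForm_sign hK (n + 1)).measurable.comp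
        measurable_fin_cons) fun q => abs_kernelForm_sign_le hk _
    rw [integral_pi_fin_succ_eq_prod, integral_prod_symm _ hi1]
    have hstep : ∀ z : Fin n → X × Bool, ∫ w : X × Bool,
        kernelForm K (fun i => ((Fin.cons w z : Fin (n + 1) → X × Bool) i).1)
          (fun i => boolSign ((Fin.cons w z : Fin (n + 1) → X × Bool) i).2) ∂(D.prod signMeasure) ≤
        k + kernelForm K (fun i => (z i).1) fun i => boolSign (z i).2 := fun z => by
      have hiz : Integrable (fun w : X × Bool =>
          kernelForm K (fun i => ((Fin.cons w z : Fin (n + 1) → X × Bool) i).1)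
          (fun i => boolSign ((Fin.cons w z : Fin (n + 1) → X × Bool) i).2))
          (D.prod signMeasure) :=
        integrable_of_abs_le ((continuous_kernelForm_sign hK (n + 1)).measurable.comp
          (measurable_fin_cons.comp (measurable_id.prodMk measurable_const)))
          fun q => abs_kernelForm_sign_le hk _
      have hdiag : Integrable (fun x => K x x) D :=
        integrable_of_abs_le (hK.comp (continuous_id.prodMk continuous_id)).measurable
          fun x => hk x x
      rw [integral_prod _ hiz]
      simp only [integral_signMeasure, kernelForm_sign_cons]
      have hcancel : ∀ p q r : ℝ, (p + boolSign true * q + r + (p + boolSign false * q + r)) / 2 =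
          p + r := fun p q r => by simp only [boolSign]; simp; ring
      simp only [hcancel]
      rw [integral_add hdiag (integrable_const _)]
      simp only [integral_const, probReal_univ, one_smul]
      gcongr
      exact (le_abs_self _).trans (abs_integral_le_of_abs_le fun x => hk x x)
    calc _ ≤ ∫ z, (k + kernelForm K (fun i => (z i).1) fun i => boolSign (z i).2) ∂P :=
          integral_mono hi1.integral_prod_right ((integrable_const _).add hi) hstep
      _ ≤ _ := by
          rw [integral_add (integrable_const _) hi]
          simp only [integral_const, probReal_univ, one_smul]
          push_cast
          linarith

/-- The loss scale: the absolute value truncated at `B`. -/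
def truncAbs (B y : ℝ) : ℝ := min B |y|

theorem lipschitzWith_truncAbs (B : ℝ) : LipschitzWith 1 (truncAbs B) := by
  have h : LipschitzWith 1 fun y : ℝ => |y| := LipschitzWith.of_dist_le_mul fun x y => by
    simpa [Real.dist_eq] using abs_abs_sub_abs_le_abs_sub x y
  exact h.const_min B

theorem truncAbs_nonneg {B : ℝ} (hB : 0 ≤ B) (y : ℝ) : 0 ≤ truncAbs B y := le_min hB (abs_nonneg y)

theorem abs_truncAbs_le {B : ℝ} (hB : 0 ≤ B) (y : ℝ) : |truncAbs B y| ≤ B := by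
  rw [abs_of_nonneg (truncAbs_nonneg hB y)]
  exact min_le_left _ _

/-- Expected uniform deviation over a kernel ball. -/
theorem integral_ciSup_deviation_le {D : Measure X} [IsProbabilityMeasure D] {K : X → X → ℝ}
    (hpos : IsPosSemidefKernel K) (hK : Continuous (Function.uncurry K)) {κ : ℝ} (hκ : 0 ≤ κ) (hk : ∀ x y, |K x y| ≤ κ ^ 2)
    {R B : ℝ} (hR : 0 ≤ R) (hB : 0 ≤ B) (n : ℕ) :
    ∫ s : Fin n → X, ⨆ u : {u : X → ℝ // InKernelBall K R u},
        ∑ j, (∫ y, truncAbs B (u.1 y) ∂D - truncAbs B (u.1 (s j))) ∂(Measure.pi fun _ => D)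
      ≤ 2 * R * κ * √n := by
  have : Nonempty {u : X → ℝ // InKernelBall K R u} := ⟨⟨_, inKernelBall_zero K hR⟩⟩
  have hU : ∀ u : {u : X → ℝ // InKernelBall K R u}, Continuous u.1 := fun u => u.2.continuous hK
  have hUA : ∀ (u : {u : X → ℝ // InKernelBall K R u}) x, |u.1 x| ≤ R * κ := fun u x =>
    (u.2.abs_le x).trans (mul_le_mul_of_nonneg_left
      (Real.sqrt_le_iff.2 ⟨hκ, (le_abs_self _).trans (hk x x)⟩) hR)
  have hsc : Continuous boolSign := continuous_of_discreteTopology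
  have hφ := lipschitzWith_truncAbs B
  have hφc := hφ.continuous
  have hdev := integral_ciSup_sum_le_of_step (D := D) (ρ := D.prod signMeasure)
    (G := fun (u : {u : X → ℝ // InKernelBall K R u}) x =>
      ∫ y, truncAbs B (u.1 y) ∂D - truncAbs B (u.1 x))
    (V := fun (u : {u : X → ℝ // InKernelBall K R u}) (z : X × Bool) =>
      2 * boolSign z.2 * u.1 z.1)
    (fun u => by have := hU u; fun_prop) (fun u => by have := hU u; fun_prop)
    (A := max (2 * B) (2 * (R * κ)))
    (fun u x => le_max_of_le_left ((abs_sub _ _).trans (by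
      have := abs_integral_le_of_abs_le (μ := D) fun x => abs_truncAbs_le hB (u.1 x)
      linarith [abs_truncAbs_le hB (u.1 x)])))
    (fun u z => le_max_of_le_right (by
      rw [abs_mul, abs_mul, abs_boolSign, abs_two]; linarith [hUA u z.1]))
    (fun a c ha => integral_ciSup_symmetrize_le hU hUA hφ (abs_truncAbs_le hB) a c ha)
    n (fun _ => 0) 0 (by simp)
  simp only [zero_add] at hdev
  refine hdev.trans ?_
  set P : Measure (Fin n → X × Bool) := Measure.pi fun _ => D.prod signMeasure
  set Q : (Fin n → X × Bool) → ℝ := fun z =>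
    kernelForm K (fun i => (z i).1) fun i => boolSign (z i).2 with hQ
  have hQi : Integrable Q P := integrable_of_abs_le (continuous_kernelForm_sign hK n).measurable
    (abs_kernelForm_sign_le hk)
  -- The definition of the ball with the random signs as coefficients: the supremum over the ball is
  -- bounded by a single quadratic form.
  have hQs : ∀ (u : {u : X → ℝ // InKernelBall K R u}) z,
      |∑ j, 2 * boolSign (z j).2 * u.1 (z j).1| ≤ 2 * R * √(Q z) := fun u z => by
    have := u.2 (Fin n) (fun i => (z i).1) fun i => boolSign (z i).2
    simp only [mul_assoc, ← Finset.mul_sum]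
    rw [abs_mul, abs_two]
    linarith
  have hsup : ∀ z, (⨆ u : {u : X → ℝ // InKernelBall K R u},
      ∑ j, 2 * boolSign (z j).2 * u.1 (z j).1) ≤ 2 * R * √(Q z) := fun z =>
    ciSup_le fun u => (le_abs_self _).trans (hQs u z)
  have hsi : Integrable (fun z => ⨆ u : {u : X → ℝ // InKernelBall K R u},
      ∑ j, 2 * boolSign (z j).2 * u.1 (z j).1) P :=
    integrable_ciSup_of_continuous (A := 2 * R * √(n * (n * κ ^ 2)))
      (fun u => by have := hU u; fun_prop)
      fun u z => (hQs u z).trans (by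
        gcongr
        exact (le_abs_self _).trans (abs_kernelForm_sign_le hk z))
  have hsqi : Integrable (fun z => √(Q z)) P :=
    integrable_of_abs_le (A := √(n * (n * κ ^ 2)))
      (continuous_kernelForm_sign hK n).measurable.sqrt fun z => by
        rw [abs_of_nonneg (Real.sqrt_nonneg _)]
        exact Real.sqrt_le_sqrt ((le_abs_self _).trans (abs_kernelForm_sign_le hk z))
  have hsqrt : ∫ z, √(Q z) ∂P ≤ κ * √n := by
    have hQ0 : ∫ z, Q z ∂P ≤ n * κ ^ 2 := integral_kernelForm_sign_le hK hk n
    -- Jensen for the square root, from nonnegativity of the variance of √Q.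
    have hjensen : (∫ z, √(Q z) ∂P) ^ 2 ≤ n * κ ^ 2 := by
      set m := ∫ z, √(Q z) ∂P
      have h := integral_nonneg (μ := P) (f := fun z => (√(Q z) - m) ^ 2) fun z => sq_nonneg _
      have hexp : ∀ z, (√(Q z) - m) ^ 2 = Q z - 2 * m * √(Q z) + m ^ 2 := fun z => by
        rw [sub_sq, Real.sq_sqrt (hpos (Fin n) _ _)]; ring
      simp only [hexp] at h
      have hi : Integrable (fun z => Q z - 2 * m * √(Q z)) P := hQi.sub (hsqi.const_mul _)
      rw [integral_add hi (integrable_const _),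
        integral_sub hQi (hsqi.const_mul _), integral_const_mul] at h
      simp only [integral_const, probReal_univ, one_smul] at h
      nlinarith
    have h := Real.le_sqrt_of_sq_le hjensen
    rwa [mul_comm, Real.sqrt_mul (sq_nonneg _), Real.sqrt_sq hκ] at h
  calc _ ≤ ∫ z, 2 * R * √(Q z) ∂P := integral_mono hsi (hsqi.const_mul _) hsup
    _ ≤ _ := by
      rw [integral_const_mul, mul_assoc (2 * R)]
      exact mul_le_mul_of_nonneg_left hsqrt (by positivity)

/-- With high probability, every element of a kernel ball that vanishes on the sample is small in
expectation. -/
theorem measure_exists_vanishing_le {D : Measure X} [IsProbabilityMeasure D] {K : X → X → ℝ}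
    (hpos : IsPosSemidefKernel K) (hK : Continuous (Function.uncurry K)) {κ : ℝ} (hκ : 0 ≤ κ) (hk : ∀ x y, |K x y| ≤ κ ^ 2)
    {R B : ℝ} (hR : 0 ≤ R) (hB : 0 < B) {n : ℕ} (hn : 0 < n) {ε r : ℝ} (hr : 0 ≤ r)
    (hε : 2 * R * κ * √n + r ≤ n * ε) :
    (Measure.pi fun _ : Fin n => D).real {s | ∃ u, InKernelBall K R u ∧ (∀ j, u (s j) = 0) ∧
        ε ≤ ∫ y, truncAbs B (u y) ∂D} ≤ Real.exp (-(2 * r ^ 2 / (n * B ^ 2))) := by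
  have : Nonempty {u : X → ℝ // InKernelBall K R u} := ⟨⟨_, inKernelBall_zero K hR⟩⟩
  have hφ := lipschitzWith_truncAbs B
  have hφc := hφ.continuous
  set f : {u : X → ℝ // InKernelBall K R u} → (Fin n → X) → ℝ := fun u s =>
    ∑ j, (∫ y, truncAbs B (u.1 y) ∂D - truncAbs B (u.1 (s j))) with hf
  have hfc : ∀ u, Continuous (f u) := fun u => by
    have := u.2.continuous hK
    fun_prop
  have hfA : ∀ u s, |f u s| ≤ 0 + n * (2 * B) := fun u s => by
    have := abs_add_sum_le (a := 0) (c := 0) (A := 2 * B)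
      (w := fun x => ∫ y, truncAbs B (u.1 y) ∂D - truncAbs B (u.1 x))
      (fun x => (abs_sub _ _).trans (by
        have := abs_integral_le_of_abs_le (μ := D) fun x => abs_truncAbs_le hB.le (u.1 x)
        linarith [abs_truncAbs_le hB.le (u.1 x)])) (by simp) s
    rwa [zero_add] at this
  -- Only one summand changes, and by at most B since `truncAbs` takes values in [0, B].
  have hdiff : ∀ s j x u, f u (Function.update s j x) ≤ f u s + B := by
    intro s j x u
    have hother : ∀ i ∈ Finset.univ.erase j, (∫ y, truncAbs B (u.1 y) ∂D -
        truncAbs B (u.1 (Function.update s j x i))) =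
        ∫ y, truncAbs B (u.1 y) ∂D - truncAbs B (u.1 (s i)) := fun i hi => by
      rw [Function.update_of_ne (Finset.ne_of_mem_erase hi)]
    simp only [hf]
    rw [← Finset.add_sum_erase _ _ (Finset.mem_univ j),
      ← Finset.add_sum_erase _ (fun i => ∫ y, truncAbs B (u.1 y) ∂D - truncAbs B (u.1 (s i)))
        (Finset.mem_univ j), Finset.sum_congr rfl hother, Function.update_self]
    have h1 := truncAbs_nonneg hB.le (u.1 x)
    have h2 : truncAbs B (u.1 (s j)) ≤ B := min_le_left _ _
    linarith
  have hle : ∀ s j x, (⨆ u, f u (Function.update s j x)) ≤ (⨆ u, f u s) + B := fun s j x =>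
    ciSup_le fun u => (hdiff s j x u).trans (add_le_add_left
      (le_ciSup (f := fun u => f u s) (bddAbove_range_of_abs_le fun u => hfA u s) u) _)
  have hmc := measure_ge_le_of_bounded_differences (D := D) hB hn (fun s => ⨆ u, f u s)
    (measurable_ciSup_of_continuous hfc hfA) (fun s => abs_ciSup_le_of_abs_le fun u => hfA u s)
    (fun s j x => abs_sub_le_iff.2 ⟨by linarith [hle s j x], by
      have := hle (Function.update s j x) j (s j)
      rw [Function.update_idem, Function.update_eq_self] at this
      linarith⟩) hr
  refine (measureReal_mono ?_).trans hmc
  rintro s ⟨u, hu, h0, hu2⟩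
  have hE := integral_ciSup_deviation_le (D := D) hpos hK hκ hk hR hB.le n
  have h1 := le_ciSup (f := fun u => f u s) (bddAbove_range_of_abs_le fun u => hfA u s) ⟨u, hu⟩
  -- For a function vanishing on the sample, the deviation is n times the expectation.
  have h2 : f ⟨u, hu⟩ s = n * ∫ y, truncAbs B (u y) ∂D := by
    simp [hf, h0, truncAbs, hB.le]
  have hn' : (0 : ℝ) < n := Nat.cast_pos.2 hn
  have h3 := mul_le_mul_of_nonneg_left hu2 hn'.le
  simp only [h2] at h1
  rw [Set.mem_ofPred_eq]
  linarith

end KernelBall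

/-! ### Kernel regression learns kernel balls -/

section Regression

variable {X : Type*} {K : X → X → ℝ}

/-- The Cauchy-Schwarz inequality of a positive semidefinite kernel. -/
theorem IsPosSemidefKernel.inKernelBall_sum (hpos : IsPosSemidefKernel K)
    (hsymm : ∀ x y, K x y = K y x) {n : ℕ} (s : Fin n → X) (α : Fin n → ℝ) :
    InKernelBall K (√(kernelForm K s α)) fun x => ∑ i, α i * K (s i) x := by
  intro ι _ t γ
  set c := ∑ j, γ j * ∑ i, α i * K (s i) (t j) with hc
  have hc1 : ∑ i, ∑ j, α i * γ j * K (s i) (t j) = c := by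
    rw [hc, Finset.sum_comm]
    simp only [Finset.mul_sum]
    exact Finset.sum_congr rfl fun _ _ => Finset.sum_congr rfl fun _ _ => by ring
  have hc2 : ∑ j, ∑ i, γ j * α i * K (t j) (s i) = c := by
    rw [← hc1, Finset.sum_comm]
    exact Finset.sum_congr rfl fun _ _ => Finset.sum_congr rfl fun _ _ => by
      rw [hsymm (t _)]; ring
  -- The form of the concatenated family (α, rγ) is a nonnegative quadratic in r, so its
  -- discriminant is nonpositive.
  have hq : ∀ r : ℝ, 0 ≤ kernelForm K t γ * (r * r) + 2 * c * r + kernelForm K s α := fun r => by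
    have h := hpos (Fin n ⊕ ι) (Sum.elim s t) (Sum.elim α fun j => r * γ j)
    refine h.trans_eq ?_
    have e1 : ∑ i, ∑ j, α i * (r * γ j) * K (s i) (t j) = r * c := by
      rw [← hc1]; simp only [Finset.mul_sum]
      exact Finset.sum_congr rfl fun _ _ => Finset.sum_congr rfl fun _ _ => by ring
    have e2 : ∑ j, ∑ i, r * γ j * α i * K (t j) (s i) = r * c := by
      rw [← hc2]; simp only [Finset.mul_sum]
      exact Finset.sum_congr rfl fun _ _ => Finset.sum_congr rfl fun _ _ => by ring
    have e3 : ∑ j, ∑ i, r * γ j * (r * γ i) * K (t j) (t i) = kernelForm K t γ * (r * r) := by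
      rw [kernelForm]; simp only [Finset.sum_mul]
      exact Finset.sum_congr rfl fun _ _ => Finset.sum_congr rfl fun _ _ => by ring
    rw [kernelForm]
    simp only [Fintype.sum_sum_type, Sum.elim_inl, Sum.elim_inr, Finset.sum_add_distrib, e1, e2, e3]
    rw [← kernelForm]
    ring
  have hd := discrim_le_zero hq
  rw [discrim] at hd
  rw [← Real.sqrt_mul (hpos _ _ _)]
  exact Real.abs_le_sqrt (by nlinarith)

/-- Kernel regression on labels from a kernel ball interpolates them and stays in the ball. -/
theorem InKernelBall.kernelRegression {R : ℝ} {f : X → ℝ} (hf : InKernelBall K R f) (hR : 0 ≤ R)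
    (hpos : IsPosSemidefKernel K) (hsymm : ∀ x y, K x y = K y x) {n : ℕ} (s : Fin n → X) :
    (∀ j, kernelRegression K n s (fun i => f (s i)) (s j) = f (s j)) ∧
      InKernelBall K R (kernelRegression K n s fun i => f (s i)) := by
  set y : Fin n → ℝ := fun i => f (s i) with hy
  set H := gram K s with hH
  set α := (exists_normal_eq H y).choose with hα
  have hn : (H.transpose * H).mulVec α = H.transpose.mulVec y :=
    (exists_normal_eq H y).choose_spec
  have hreg : ∀ x, _root_.kernelRegression K n s y x = ∑ i, α i * K (s i) x := fun x => rfl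
  have hform : ∀ γ : Fin n → ℝ, kernelForm K s γ = γ ⬝ᵥ H.mulVec γ := fun γ => by
    simp only [kernelForm, dotProduct, Matrix.mulVec, hH, gram, Matrix.of_apply, Finset.mul_sum]
    exact Finset.sum_congr rfl fun _ _ => Finset.sum_congr rfl fun _ _ => by ring
  -- H may be singular. The residual z is orthogonal to the range of H, so its kernel form vanishes,
  -- and ball membership of f forces z ⊥ y; hence z = 0.
  set z := H.mulVec α - y with hz
  have hz0 : H.transpose.mulVec z = 0 := by
    rw [hz, Matrix.mulVec_sub, Matrix.mulVec_mulVec, hn, sub_self]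
  have hzH : ∀ γ, z ⬝ᵥ H.mulVec γ = 0 := fun γ => by
    rw [Matrix.dotProduct_mulVec, ← Matrix.mulVec_transpose, hz0, zero_dotProduct]
  have hzy : z ⬝ᵥ y = 0 := by
    have h := hf (Fin n) s z
    rw [hform, hzH, Real.sqrt_zero, mul_zero] at h
    exact abs_nonpos_iff.1 h
  have hzz : z ⬝ᵥ z = 0 := by
    conv_lhs => rw [hz, dotProduct_sub, ← hz, hzH, hzy, sub_zero]
  have hint : H.mulVec α = y := sub_eq_zero.1 (dotProduct_self_eq_zero.1 hzz)
  refine ⟨fun j => ?_, ?_⟩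
  · rw [hreg]
    have := congrFun hint j
    simp only [Matrix.mulVec, dotProduct, hH, gram, Matrix.of_apply] at this
    change _ = y j
    rw [← this]
    exact Finset.sum_congr rfl fun i _ => by rw [hsymm (s j), mul_comm]
  -- With ‖f̂‖² = αᵀHα = αᵀy, testing f against α gives ‖f̂‖² ≤ R ‖f̂‖.
  · refine (hpos.inKernelBall_sum hsymm s α).mono ?_
    have h := (le_abs_self _).trans (hf (Fin n) s α)
    have h1 : kernelForm K s α = ∑ i, α i * f (s i) := by rw [hform, hint]; rfl
    rw [← h1] at h
    have h0 := hpos _ s α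
    rcases h0.eq_or_lt with h0 | h0
    · rw [← h0, Real.sqrt_zero]; exact hR
    · have hs := Real.sqrt_pos.2 h0
      have h2 : √(kernelForm K s α) * √(kernelForm K s α) ≤ R * √(kernelForm K s α) := by
        rwa [Real.mul_self_sqrt h0.le]
      exact le_of_mul_le_mul_right h2 hs

variable [TopologicalSpace X] [SecondCountableTopology X] [MeasurableSpace X] [BorelSpace X]

-- The loss vanishes on the diagonal, so the Lipschitz condition bounds it by |f − g|, besides the
-- bound B.
omit [SecondCountableTopology X] in
theorem generalizationError_lt {B : ℝ} {L : ℝ → ℝ → ℝ} (hL : IsLoss B L) {D : Measure X}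
    [IsProbabilityMeasure D] {f g : X → ℝ} {B' : ℝ} (hB : B ≤ B') (hB' : 0 ≤ B')
    (hc : Continuous fun x => f x - g x)
    {ε : ℝ} (hε : ∫ x, truncAbs B' (f x - g x) ∂D < ε) :
    generalizationError L D f g < ENNReal.ofReal ε := by
  have hle : ∀ x, L (f x) (g x) ≤ truncAbs B' (f x - g x) := fun x => by
    refine le_min ((hL.le_bound _ _).trans hB) ?_
    have h := (hL.lipschitz (f x)).dist_le_mul (g x) (f x)
    rw [Real.dist_eq, Real.dist_eq, hL.self_eq_zero, NNReal.coe_one, one_mul, sub_zero,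
      abs_sub_comm (g x)] at h
    exact (le_abs_self _).trans h
  have hφc := (lipschitzWith_truncAbs B').continuous
  have h0 : 0 ≤ ∫ x, truncAbs B' (f x - g x) ∂D := integral_nonneg fun x => truncAbs_nonneg hB' _
  calc generalizationError L D f g
      ≤ ∫⁻ x, ENNReal.ofReal (truncAbs B' (f x - g x)) ∂D :=
        lintegral_mono fun x => ENNReal.ofReal_le_ofReal (hle x)
    _ = ENNReal.ofReal (∫ x, truncAbs B' (f x - g x) ∂D) :=
        (ofReal_integral_eq_lintegral_ofReal
          (integrable_of_abs_le (hφc.comp hc).measurable fun x => abs_truncAbs_le hB' _)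
          (Filter.Eventually.of_forall fun x => truncAbs_nonneg hB' _)).symm
    _ < ENNReal.ofReal ε := (ENNReal.ofReal_lt_ofReal_iff (h0.trans_lt hε)).2 hε

/-- Functions in a kernel ball are efficiently learned by kernel regression. -/
theorem InKernelBall.efficientlyLearnedWith {κ B B' C c : ℝ} {L : ℝ → ℝ → ℝ} (hL : IsLoss B L)
    (hB : B ≤ B') (hB' : 0 < B') (hpos : IsPosSemidefKernel K) (hsymm : ∀ x y, K x y = K y x)
    (hK : Continuous (Function.uncurry K)) (hκ : 0 ≤ κ) (hk : ∀ x y, |K x y| ≤ κ ^ 2)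
    (hc : 0 ≤ c) {M : ℝ} (hM : 0 ≤ M) {f : X → ℝ} (hf : InKernelBall K (c * √M) f)
    (hC : 2 * (4 * c * κ + B' + 1) ^ 2 ≤ C) :
    EfficientlyLearnedWith (_root_.kernelRegression K) L C f M := by
  intro ε δ hε hδ hδ1 D hD
  have hcM : 0 ≤ c * √M := by positivity
  set ℓ := Real.log δ⁻¹ with hℓ
  have hℓ0 : 0 < ℓ := Real.log_pos ((one_lt_inv₀ hδ).2 hδ1)
  have hC0 : 0 < C := lt_of_lt_of_le (by positivity) hC
  set q := C * (M + ℓ) / ε ^ 2 with hq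
  have hq0 : 0 ≤ q := by positivity
  -- The sample complexity is an integer, so the allowed number of examples is q rounded down.
  suffices h : Succeeds (_root_.kernelRegression K) L f D ε δ ⌊q⌋₊ by
    have h1 : sampleComplexity (_root_.kernelRegression K) L f D ε δ ≤ (⌊q⌋₊ : ℕ∞) :=
      sInf_le ⟨_, rfl, h⟩
    calc (sampleComplexity (_root_.kernelRegression K) L f D ε δ : ℝ≥0∞)
        ≤ ((⌊q⌋₊ : ℕ∞) : ℝ≥0∞) := by exact_mod_cast h1
      _ = ENNReal.ofReal (⌊q⌋₊ : ℝ) := by simp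
      _ ≤ ENNReal.ofReal q := ENNReal.ofReal_le_ofReal (Nat.floor_le hq0)
  have hdiff : ∀ {n : ℕ} (s : Fin n → X), InKernelBall K (2 * (c * √M))
      fun x => f x - _root_.kernelRegression K n s (fun i => f (s i)) x := fun s => by
    rw [two_mul]
    exact hf.sub (hf.kernelRegression hcM hpos hsymm s).2
  have hfail : ∀ n : ℕ, {s : Fin n → X | ¬ generalizationError L D f
      (_root_.kernelRegression K n s fun i => f (s i)) < ENNReal.ofReal ε} ⊆
      {s | ∃ u, InKernelBall K (2 * (c * √M)) u ∧ (∀ j, u (s j) = 0) ∧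
        ε ≤ ∫ y, truncAbs B' (u y) ∂D} := by
    intro n s hs
    refine ⟨_, hdiff s, fun j => ?_, ?_⟩
    · rw [(hf.kernelRegression hcM hpos hsymm s).1 j, sub_self]
    · by_contra hlt
      exact hs (generalizationError_lt hL hB hB'.le ((hdiff s).continuous hK) (not_le.1 hlt))
  rw [Succeeds]
  rcases Nat.eq_zero_or_pos ⌊q⌋₊ with h0 | hpos'
  -- No examples are allowed: the model is 0, and q < 1 forces |f| ≤ c κ √M < ε.
  · have hq1 : q < 1 := Nat.floor_eq_zero.1 h0
    rw [h0]
    have hCM : (c * κ * √M) ^ 2 < ε ^ 2 := by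
      have h1 : C * (M + ℓ) < ε ^ 2 := by rwa [hq, div_lt_one (by positivity)] at hq1
      have h2 : (c * κ) ^ 2 ≤ C := by nlinarith [mul_nonneg hc hκ]
      rw [mul_pow, Real.sq_sqrt hM]
      nlinarith [mul_le_mul_of_nonneg_right h2 hM, mul_pos hC0 hℓ0]
    have hlt : c * κ * √M < ε := lt_of_pow_lt_pow_left₀ 2 hε.le hCM
    have hreg : ∀ s : Fin 0 → X,
        _root_.kernelRegression K 0 s (fun i => f (s i)) = fun _ => 0 := fun s => by
      funext x
      simp [_root_.kernelRegression]
    have hsmall : ∫ x, truncAbs B' (f x - 0) ∂D < ε := by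
      refine ((le_abs_self _).trans (abs_integral_le_of_abs_le (A := c * κ * √M)
        fun x => ?_)).trans_lt hlt
      rw [abs_of_nonneg (truncAbs_nonneg hB'.le _), sub_zero]
      refine (min_le_right _ _).trans ((hf.abs_le x).trans ?_)
      have : √(K x x) ≤ κ := Real.sqrt_le_iff.2 ⟨hκ, (le_abs_self _).trans (hk x x)⟩
      calc c * √M * √(K x x) ≤ c * √M * κ := mul_le_mul_of_nonneg_left this hcM
        _ = c * κ * √M := by ring
    have hempty : {s : Fin 0 → X | ¬ generalizationError L D f
        (_root_.kernelRegression K 0 s fun i => f (s i)) < ENNReal.ofReal ε} = ∅ := by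
      refine Set.eq_empty_of_forall_notMem fun s hs => hs ?_
      rw [hreg]
      refine generalizationError_lt hL hB hB'.le ?_ hsmall
      simpa using hf.continuous hK
    rw [hempty, measure_empty]
    exact ENNReal.ofReal_pos.2 hδ
  · set n := ⌊q⌋₊ with hn
    have hn' : (0 : ℝ) < n := Nat.cast_pos.2 hpos'
    -- Rounding down loses at most a factor 2, the leading 2 in the bound on C.
    have hqn : q ≤ 2 * n := by
      have := Nat.lt_floor_add_one q
      have : (1 : ℝ) ≤ n := by exact_mod_cast hpos'
      linarith
    -- Makes the failure probability at most δ², strictly below δ.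
    set r := B' * √(n * ℓ) with hr
    have hr0 : 0 ≤ r := by positivity
    have hnε : 2 * (2 * (c * √M)) * κ * √n + r ≤ n * ε := by
      have h1 : C * (M + ℓ) ≤ 2 * n * ε ^ 2 := by
        rwa [hq, div_le_iff₀ (by positivity)] at hqn
      have hcκ : 0 ≤ 4 * c * κ := by positivity
      have h2 : ((4 * c * κ + B') * √(M + ℓ)) ^ 2 ≤ (√n * ε) ^ 2 := by
        rw [mul_pow, mul_pow, Real.sq_sqrt (by positivity), Real.sq_sqrt hn'.le]
        have h3 : 2 * (4 * c * κ + B') ^ 2 ≤ C := by nlinarith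
        nlinarith [mul_le_mul_of_nonneg_right h3 (by positivity : 0 ≤ M + ℓ)]
      have h4 : (4 * c * κ + B') * √(M + ℓ) ≤ √n * ε :=
        (sq_le_sq₀ (by positivity) (by positivity)).1 h2
      have hM1 : √M ≤ √(M + ℓ) := Real.sqrt_le_sqrt (by linarith)
      have hℓ1 : √ℓ ≤ √(M + ℓ) := Real.sqrt_le_sqrt (by linarith)
      calc 2 * (2 * (c * √M)) * κ * √n + r = (4 * c * κ * √M + B' * √ℓ) * √n := by
            rw [hr, Real.sqrt_mul hn'.le]; ring
        _ ≤ (√n * ε) * √n := by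
            refine mul_le_mul_of_nonneg_right (le_trans ?_ h4) (Real.sqrt_nonneg _)
            rw [add_mul]
            gcongr
        _ = n * ε := by rw [mul_right_comm, Real.mul_self_sqrt hn'.le]
    have h := measure_exists_vanishing_le (D := D) hpos hK hκ hk (R := 2 * (c * √M)) (by positivity)
      hB' hpos' hr0 hnε
    have hexp : Real.exp (-(2 * r ^ 2 / (n * B' ^ 2))) = δ ^ 2 := by
      have : -(2 * r ^ 2 / (n * B' ^ 2)) = Real.log δ + Real.log δ := by
        rw [hr, mul_pow, Real.sq_sqrt (by positivity), hℓ, Real.log_inv]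
        field_simp
        ring
      rw [this, Real.exp_add, Real.exp_log hδ, sq]
    rw [hexp] at h
    refine (measure_mono (hfail n)).trans_lt ?_
    rw [← ofReal_measureReal, ENNReal.ofReal_lt_ofReal_iff hδ]
    exact h.trans_lt (by nlinarith)

end Regression

/-! ### Dot-product kernels and the norms of monomials -/

section DotKernel

variable {d : ℕ}

theorem inner_pow_eq_sum (k : ℕ) (x y : EuclideanSpace ℝ (Fin d)) :
    (inner ℝ x y) ^ k = ∑ m : Fin k → Fin d, (∏ j, x (m j)) * ∏ j, y (m j) := by
  have h : (inner ℝ x y) ^ k = ∏ _j : Fin k, ∑ i, x i * y i := by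
    simp [PiLp.inner_apply, mul_comm]
  rw [h, Finset.prod_univ_sum, Fintype.piFinset_univ]
  simp only [Finset.prod_mul_distrib]

theorem prod_inner_eq_sum {k : ℕ} (β : Fin k → EuclideanSpace ℝ (Fin d))
    (y : EuclideanSpace ℝ (Fin d)) :
    ∏ j, inner ℝ (β j) y = ∑ m : Fin k → Fin d, (∏ j, β j (m j)) * ∏ j, y (m j) := by
  have h : ∏ j, inner ℝ (β j) y = ∏ j : Fin k, ∑ i, β j i * y i := by
    simp [PiLp.inner_apply, mul_comm]
  rw [h, Finset.prod_univ_sum, Fintype.piFinset_univ]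
  simp only [Finset.prod_mul_distrib]

theorem prod_norm_sq_eq_sum {k : ℕ} (β : Fin k → EuclideanSpace ℝ (Fin d)) :
    (∏ j, ‖β j‖) ^ 2 = ∑ m : Fin k → Fin d, (∏ j, β j (m j)) ^ 2 := by
  have h : (∏ j, ‖β j‖) ^ 2 = ∏ j : Fin k, ∑ i, (β j i) ^ 2 := by
    rw [← Finset.prod_pow]
    simp [EuclideanSpace.norm_sq_eq]
  rw [h, Finset.prod_univ_sum, Fintype.piFinset_univ]
  simp only [Finset.prod_pow]

/-- The form is the squared norm of the tensor Σ αᵢ e(sᵢ)^{⊗k}, in coordinates indexed by m. -/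
theorem kernelForm_inner_pow_eq_sum {X : Type*} (e : X → EuclideanSpace ℝ (Fin d)) (k : ℕ)
    {ι : Type*} [Fintype ι] (s : ι → X) (α : ι → ℝ) :
    kernelForm (fun x y => (inner ℝ (e x) (e y)) ^ k) s α =
      ∑ m : Fin k → Fin d, (∑ i, α i * ∏ j, e (s i) (m j)) ^ 2 := by
  simp only [kernelForm, inner_pow_eq_sum, sq, Finset.sum_mul_sum]
  symm
  rw [Finset.sum_comm]
  refine Finset.sum_congr rfl fun i _ => ?_
  rw [Finset.sum_comm]
  refine Finset.sum_congr rfl fun j _ => ?_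
  rw [Finset.mul_sum]
  exact Finset.sum_congr rfl fun m _ => by ring

theorem kernelForm_inner_pow_nonneg {X : Type*} (e : X → EuclideanSpace ℝ (Fin d)) (k : ℕ)
    {ι : Type*} [Fintype ι] (s : ι → X) (α : ι → ℝ) :
    0 ≤ kernelForm (fun x y => (inner ℝ (e x) (e y)) ^ k) s α := by
  rw [kernelForm_inner_pow_eq_sum]
  exact Finset.sum_nonneg fun _ _ => sq_nonneg _

/-- Cauchy–Schwarz between β₁ ⊗ ⋯ ⊗ β_k, of norm ∏ ‖βⱼ‖, and Σ αᵢ e(sᵢ)^{⊗k}. -/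
theorem abs_sum_prod_inner_le {X : Type*} (e : X → EuclideanSpace ℝ (Fin d)) {k : ℕ}
    (β : Fin k → EuclideanSpace ℝ (Fin d)) {ι : Type*} [Fintype ι] (s : ι → X) (α : ι → ℝ) :
    |∑ i, α i * ∏ j, inner ℝ (β j) (e (s i))| ≤
      (∏ j, ‖β j‖) * √(kernelForm (fun x y => (inner ℝ (e x) (e y)) ^ k) s α) := by
  have h0 : 0 ≤ ∏ j, ‖β j‖ := Finset.prod_nonneg fun _ _ => norm_nonneg _
  have h : ∑ i, α i * ∏ j, inner ℝ (β j) (e (s i)) =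
      ∑ m : Fin k → Fin d, (∏ j, β j (m j)) * ∑ i, α i * ∏ j, e (s i) (m j) := by
    simp only [prod_inner_eq_sum, Finset.mul_sum]
    rw [Finset.sum_comm]
    exact Finset.sum_congr rfl fun _ _ => Finset.sum_congr rfl fun _ _ => by ring
  rw [h, kernelForm_inner_pow_eq_sum, ← Real.sqrt_sq h0, prod_norm_sq_eq_sum,
    ← Real.sqrt_mul (Finset.sum_nonneg fun _ _ => sq_nonneg _)]
  exact Real.abs_le_sqrt (Finset.sum_mul_sq_le_sq_mul_sq _ _ _)

variable {b : ℕ → ℝ}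

theorem SlowlyDecaying.pos (hb : SlowlyDecaying b) (k : ℕ) : 0 < b k := by
  obtain ⟨-, c, hc, h⟩ := hb
  exact lt_of_lt_of_le (by positivity) (h k)

theorem abs_inner_sphere_le (x y : UnitSphere d) :
    |inner ℝ (x : EuclideanSpace ℝ (Fin d)) y| ≤ 1 := by
  have h := abs_real_inner_le_norm (x : EuclideanSpace ℝ (Fin d)) y
  rwa [norm_eq_of_mem_sphere, norm_eq_of_mem_sphere, one_mul] at h

theorem SlowlyDecaying.norm_term_le (hb : SlowlyDecaying b) (k : ℕ) (x y : UnitSphere d) :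
    ‖b k * (inner ℝ (x : EuclideanSpace ℝ (Fin d)) y) ^ k‖ ≤ b k := by
  rw [norm_mul, norm_pow, Real.norm_of_nonneg (hb.pos k).le]
  exact mul_le_of_le_one_right (hb.pos k).le
    (pow_le_one₀ (norm_nonneg _) (abs_inner_sphere_le x y))

theorem SlowlyDecaying.hasSum_dotKernel (hb : SlowlyDecaying b) (x y : UnitSphere d) :
    HasSum (fun k => b k * (inner ℝ (x : EuclideanSpace ℝ (Fin d)) y) ^ k) (dotKernel b x y) :=
  (Summable.of_norm_bounded hb.1 fun k => hb.norm_term_le k x y).hasSum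

theorem SlowlyDecaying.continuous_dotKernel (hb : SlowlyDecaying b) :
    Continuous (Function.uncurry (dotKernel b (d := d))) := by
  refine continuous_tsum (fun k => ?_) hb.1 fun k q => hb.norm_term_le k q.1 q.2
  fun_prop

theorem SlowlyDecaying.abs_dotKernel_le (hb : SlowlyDecaying b) (x y : UnitSphere d) :
    |dotKernel b x y| ≤ ∑' k, b k :=
  tsum_of_norm_bounded hb.1.hasSum fun k => hb.norm_term_le k x y

theorem dotKernel_comm (x y : UnitSphere d) : dotKernel b x y = dotKernel b y x := by
  simp only [dotKernel, real_inner_comm]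

theorem SlowlyDecaying.hasSum_kernelForm (hb : SlowlyDecaying b) {ι : Type*} [Fintype ι]
    (s : ι → UnitSphere d) (α : ι → ℝ) :
    HasSum (fun k => b k * kernelForm (fun x y : UnitSphere d =>
      (inner ℝ (x : EuclideanSpace ℝ (Fin d)) y) ^ k) s α) (kernelForm (dotKernel b) s α) := by
  have h := hasSum_sum (s := Finset.univ) fun i (_ : i ∈ Finset.univ) =>
    hasSum_sum (s := Finset.univ) fun j (_ : j ∈ Finset.univ) =>
      (hb.hasSum_dotKernel (s i) (s j)).mul_left (α i * α j)
  refine h.congr_fun ?_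
  intro k
  simp only [kernelForm, Finset.mul_sum]
  exact Finset.sum_congr rfl fun _ _ => Finset.sum_congr rfl fun _ _ => by ring

theorem SlowlyDecaying.isPosSemidefKernel (hb : SlowlyDecaying b) :
    IsPosSemidefKernel (dotKernel b (d := d)) := fun _ _ s α =>
  (hb.hasSum_kernelForm s α).nonneg fun k => mul_nonneg (hb.pos k).le
    (kernelForm_inner_pow_nonneg (fun x : UnitSphere d => (x : EuclideanSpace ℝ (Fin d))) k s α)

/-- A monomial lies in a kernel ball whose radius grows linearly with its degree. -/
theorem SlowlyDecaying.inKernelBall_monomial (hb : SlowlyDecaying b) {c : ℝ} (hc : 0 < c)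
    (hbc : ∀ k : ℕ, c / ((k : ℝ) + 1) ^ 2 ≤ b k) {k : ℕ} (a : ℝ)
    (β : Fin k → EuclideanSpace ℝ (Fin d)) :
    InKernelBall (dotKernel b) ((√c)⁻¹ * ((|a| * ∏ j, ‖β j‖) * (k + 1)))
      fun x : UnitSphere d => a * ∏ j, inner ℝ (β j) (x : EuclideanSpace ℝ (Fin d)) := by
  intro ι _ s α
  set F := kernelForm (fun x y : UnitSphere d =>
    (inner ℝ (x : EuclideanSpace ℝ (Fin d)) y) ^ k) s α with hF
  have hF0 : 0 ≤ F :=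
    kernelForm_inner_pow_nonneg (fun x : UnitSphere d => (x : EuclideanSpace ℝ (Fin d))) k s α
  -- All degrees contribute nonnegatively, so the degree k part alone is a lower bound.
  have hle : b k * F ≤ kernelForm (dotKernel b) s α :=
    le_hasSum (hb.hasSum_kernelForm s α) k fun l _ => mul_nonneg (hb.pos l).le
      (kernelForm_inner_pow_nonneg (fun x : UnitSphere d => (x : EuclideanSpace ℝ (Fin d))) l s α)
  have hsq : √F ≤ (√c)⁻¹ * (k + 1) * √(kernelForm (dotKernel b) s α) := by
    refine Real.sqrt_le_iff.2 ⟨by positivity, ?_⟩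
    have h1 := (mul_le_mul_of_nonneg_right (hbc k) hF0).trans hle
    rw [mul_pow, mul_pow, inv_pow, Real.sq_sqrt hc.le, Real.sq_sqrt (hb.isPosSemidefKernel _ _ _)]
    rw [div_mul_eq_mul_div, div_le_iff₀ (by positivity)] at h1
    rw [mul_assoc, ← div_eq_inv_mul, le_div_iff₀ hc]
    linarith
  have h := abs_sum_prod_inner_le (fun x : UnitSphere d => (x : EuclideanSpace ℝ (Fin d))) β s α
  have hmul : ∑ i, α i * (a * ∏ j, inner ℝ (β j) (s i : EuclideanSpace ℝ (Fin d))) =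
      a * ∑ i, α i * ∏ j, inner ℝ (β j) (s i : EuclideanSpace ℝ (Fin d)) := by
    rw [Finset.mul_sum]
    exact Finset.sum_congr rfl fun _ _ => by ring
  have h0 : 0 ≤ ∏ j, ‖β j‖ := Finset.prod_nonneg fun _ _ => norm_nonneg _
  rw [hmul, abs_mul]
  calc |a| * |∑ i, α i * ∏ j, inner ℝ (β j) (s i : EuclideanSpace ℝ (Fin d))|
      ≤ |a| * ((∏ j, ‖β j‖) * ((√c)⁻¹ * (k + 1) * √(kernelForm (dotKernel b) s α))) := by
        refine mul_le_mul_of_nonneg_left (h.trans ?_) (abs_nonneg a)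
        exact mul_le_mul_of_nonneg_left hsq h0
    _ = _ := by ring

/-- Triangle inequality for infinite sums; the dual description needs only pointwise convergence, no
completeness. -/
theorem InKernelBall.hasSum {X T : Type*} {K : X → X → ℝ} {u : T → X → ℝ} {v : X → ℝ} {R : T → ℝ}
    {S : ℝ} (hu : ∀ t, InKernelBall K (R t) (u t)) (hR : HasSum R S)
    (hv : ∀ x, HasSum (fun t => u t x) (v x)) : InKernelBall K S v := by
  intro ι _ s α
  have h1 := hasSum_sum (s := Finset.univ) fun i (_ : i ∈ Finset.univ) =>
    (hv (s i)).mul_left (α i)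
  have h2 := hR.mul_right √(kernelForm K s α)
  rw [← h1.tsum_eq]
  exact tsum_of_norm_bounded h2 fun t => (Real.norm_eq_abs _).trans_le (hu t ι s α)

end DotKernel

/-! ### Calculus of weighted expansions -/

section Expansion

variable {d : ℕ}

/-- `u` is the sum of monomials in linear forms whose weights sum to `A` and whose weights times
degrees sum to `A'`. -/
def HasExpansion (u : UnitSphere d → ℝ) (A A' : ℝ) : Prop :=
  ∃ (T : Type) (k : T → ℕ) (a : T → ℝ) (β : (t : T) → Fin (k t) → EuclideanSpace ℝ (Fin d)),
    HasSum (fun t => |a t| * ∏ j, ‖β t j‖) A ∧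
    HasSum (fun t => (|a t| * ∏ j, ‖β t j‖) * k t) A' ∧
    ∀ x : UnitSphere d,
      HasSum (fun t => a t * ∏ j, inner ℝ (β t j) (x : EuclideanSpace ℝ (Fin d))) (u x)

theorem SlowlyDecaying.inKernelBall_of_hasExpansion {b : ℕ → ℝ} (hb : SlowlyDecaying b) {c : ℝ}
    (hc : 0 < c) (hbc : ∀ k : ℕ, c / ((k : ℝ) + 1) ^ 2 ≤ b k) {u : UnitSphere d → ℝ} {A A' : ℝ}
    (hu : HasExpansion u A A') : InKernelBall (dotKernel b) ((√c)⁻¹ * (A' + A)) u := by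
  obtain ⟨T, k, a, β, h1, h2, h3⟩ := hu
  refine InKernelBall.hasSum (fun t => hb.inKernelBall_monomial hc hbc (a t) (β t)) ?_ h3
  simpa only [mul_add, mul_one] using (h2.add h1).mul_left (√c)⁻¹

theorem abs_prod_inner_le {k : ℕ} (a : ℝ) (β : Fin k → EuclideanSpace ℝ (Fin d))
    (x : UnitSphere d) :
    ‖a * ∏ j, inner ℝ (β j) (x : EuclideanSpace ℝ (Fin d))‖ ≤ |a| * ∏ j, ‖β j‖ := by
  rw [norm_mul, Real.norm_eq_abs, norm_prod]
  refine mul_le_mul_of_nonneg_left (Finset.prod_le_prod (fun _ _ => norm_nonneg _) fun j _ => ?_)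
    (abs_nonneg a)
  have := abs_real_inner_le_norm (β j) (x : EuclideanSpace ℝ (Fin d))
  rwa [norm_eq_of_mem_sphere, mul_one] at this

theorem HasExpansion.abs_le {u : UnitSphere d → ℝ} {A A' : ℝ} (hu : HasExpansion u A A')
    (x : UnitSphere d) : |u x| ≤ A := by
  obtain ⟨T, k, a, β, h1, -, h3⟩ := hu
  rw [← (h3 x).tsum_eq]
  exact tsum_of_norm_bounded h1 fun t => abs_prod_inner_le _ _ x

theorem hasExpansion_const (c : ℝ) : HasExpansion (fun _ : UnitSphere d => c) |c| 0 :=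
  ⟨Unit, fun _ => 0, fun _ => c, fun _ j => j.elim0, by simp, by simp, fun x => by simp⟩

/-- Weights multiply and degrees add, so the degree-weighted total obeys the Leibniz rule. -/
theorem HasExpansion.mul {u v : UnitSphere d → ℝ} {A A' E E' : ℝ} (hu : HasExpansion u A A')
    (hv : HasExpansion v E E') : HasExpansion (fun x => u x * v x) (A * E) (A' * E + A * E') := by
  obtain ⟨T, k, a, β, h1, h2, h3⟩ := hu
  obtain ⟨S, l, e, γ, g1, g2, g3⟩ := hv
  have hβ : ∀ t, 0 ≤ |a t| * ∏ j, ‖β t j‖ := fun t =>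
    mul_nonneg (abs_nonneg _) (Finset.prod_nonneg fun _ _ => norm_nonneg _)
  have hγ : ∀ t, 0 ≤ |e t| * ∏ j, ‖γ t j‖ := fun t =>
    mul_nonneg (abs_nonneg _) (Finset.prod_nonneg fun _ _ => norm_nonneg _)
  have key : ∀ {f : T → ℝ} {g : S → ℝ} {p q : ℝ}, HasSum f p → HasSum g q →
      (∀ t, 0 ≤ f t) → (∀ t, 0 ≤ g t) → HasSum (fun z : T × S => f z.1 * g z.2) (p * q) :=
    fun hf hg f0 g0 => hf.mul hg (hf.summable.mul_of_nonneg hg.summable f0 g0)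
  refine ⟨T × S, fun z => k z.1 + l z.2, fun z => a z.1 * e z.2,
    fun z => Fin.append (β z.1) (γ z.2), ?_, ?_, fun x => ?_⟩
  · refine (key h1 g1 hβ hγ).congr_fun fun z => ?_
    simp only [Fin.prod_univ_add, Fin.append_left, Fin.append_right, abs_mul]
    ring
  · refine ((key h2 g1 (fun t => mul_nonneg (hβ t) (Nat.cast_nonneg _)) hγ).add
      (key h1 g2 hβ fun t => mul_nonneg (hγ t) (Nat.cast_nonneg _))).congr_fun fun z => ?_
    simp only [Fin.prod_univ_add, Fin.append_left, Fin.append_right, abs_mul, Nat.cast_add]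
    ring
  · have hs : Summable fun z : T × S =>
        (a z.1 * ∏ j, inner ℝ (β z.1 j) (x : EuclideanSpace ℝ (Fin d))) *
          (e z.2 * ∏ j, inner ℝ (γ z.2 j) (x : EuclideanSpace ℝ (Fin d))) := by
      refine Summable.of_norm_bounded (key h1 g1 hβ hγ).summable fun z => ?_
      rw [norm_mul]
      exact mul_le_mul (abs_prod_inner_le _ _ x) (abs_prod_inner_le _ _ x) (norm_nonneg _) (hβ _)
    refine ((h3 x).mul (g3 x) hs).congr_fun fun z => ?_
    simp only [Fin.prod_univ_add, Fin.append_left, Fin.append_right]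
    ring

theorem HasExpansion.pow {u : UnitSphere d → ℝ} {A A' : ℝ} (hu : HasExpansion u A A') (n : ℕ) :
    HasExpansion (fun x => u x ^ n) (A ^ n) (n * A ^ (n - 1) * A') := by
  induction n with
  | zero => simpa using hasExpansion_const (d := d) 1
  | succ n ih =>
    have h := ih.mul hu
    simp only [← pow_succ] at h
    convert! h using 1
    rcases n with _ | n
    · simp
    · simp only [Nat.add_sub_cancel]
      push_cast
      ring

/-- Index by the disjoint union. Nonnegative weights can be summed in any order, and they dominate
the terms at every point of the sphere. -/
theorem hasExpansion_of_hasSum {u : ℕ → UnitSphere d → ℝ} {v : UnitSphere d → ℝ} {A A' : ℕ → ℝ}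
    {S S' : ℝ} (hu : ∀ n, HasExpansion (u n) (A n) (A' n)) (hA : HasSum A S) (hA' : HasSum A' S')
    (hv : ∀ x, HasSum (fun n => u n x) (v x)) : HasExpansion v S S' := by
  choose T k a β h1 h2 h3 using hu
  have hβ : ∀ n t, 0 ≤ |a n t| * ∏ j, ‖β n t j‖ := fun n t =>
    mul_nonneg (abs_nonneg _) (Finset.prod_nonneg fun _ _ => norm_nonneg _)
  have key : ∀ {f : (n : ℕ) → T n → ℝ} {p : ℕ → ℝ} {P : ℝ}, (∀ n, HasSum (f n) (p n)) →
      HasSum p P → (∀ n t, 0 ≤ f n t) → HasSum (fun z : (n : ℕ) × T n => f z.1 z.2) P := by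
    intro f p P hf hp h0
    have hs : Summable fun z : (n : ℕ) × T n => f z.1 z.2 :=
      (summable_sigma_of_nonneg fun z => h0 _ _).2 ⟨fun n => (hf n).summable, by
        simpa only [(hf _).tsum_eq] using hp.summable⟩
    exact HasSum.sigma_of_hasSum hp hf hs
  have hw := key h1 hA hβ
  refine ⟨(n : ℕ) × T n, fun z => k z.1 z.2, fun z => a z.1 z.2, fun z => β z.1 z.2, hw,
    key h2 hA' fun n t => mul_nonneg (hβ n t) (Nat.cast_nonneg _), fun x => ?_⟩
  exact HasSum.sigma_of_hasSum (hv x) (fun n => h3 n x)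
    (Summable.of_norm_bounded hw.summable fun z => abs_prod_inner_le _ _ x)

theorem MultiSeries.hasExpansion {P : MultiSeries d} {h : UnitSphere d → ℝ} (hP : P.Represents h)
    (hc : P.ConvergesAtOne) :
    HasExpansion h (∑' k, P.auxCoeff k) (∑' k : ℕ, (k : ℝ) * P.auxCoeff k) := by
  have hu : ∀ k, HasExpansion (fun x : UnitSphere d =>
      ∑' v, P.a k v * ∏ i, inner ℝ (P.β k v i) (x : EuclideanSpace ℝ (Fin d)))
      (P.auxCoeff k) (k * P.auxCoeff k) := fun k =>
    ⟨P.V k, fun _ => k, P.a k, P.β k, (hc.weight k).hasSum,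
      by
        rw [mul_comm]
        exact (hc.weight k).hasSum.mul_right (k : ℝ), fun x =>
      (Summable.of_norm_bounded (hc.weight k) fun v => abs_prod_inner_le _ _ x).hasSum⟩
  refine hasExpansion_of_hasSum hu hc.aux.hasSum hc.aux_deriv.hasSum fun x => ?_
  rw [hP x]
  exact (Summable.of_norm_bounded hc.aux fun k => (hu k).abs_le x).hasSum

end Expansion

/-! ### Derivatives of the auxiliary functions -/

section AuxiliaryDerivatives

theorem summable_univariateAux {p : FormalMultilinearSeries ℝ ℝ ℝ} {y : ℝ} (hy : 0 ≤ y)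
    (h : ENNReal.ofReal y < p.radius) : Summable fun n => |p.coeff n| * y ^ n := by
  have := p.summable_norm_mul_pow (r := y.toNNReal) h
  simpa only [FormalMultilinearSeries.norm_apply_eq_norm_coef, Real.norm_eq_abs,
    Real.coe_toNNReal _ hy] using this

/-- Termwise differentiation on (−ρ, ρ) with y < ρ < r < radius, the derivative series being
dominated by a multiple of n (ρ/r)ⁿ. -/
theorem hasDerivAt_univariateAux {p : FormalMultilinearSeries ℝ ℝ ℝ} {y : ℝ} (hy : 0 ≤ y)
    (h : ENNReal.ofReal y < p.radius) :
    HasSum (fun n : ℕ => |p.coeff n| * (n * y ^ (n - 1))) (deriv (univariateAux p) y) := by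
  obtain ⟨r, hyr, hr⟩ := ENNReal.lt_iff_exists_nnreal_btwn.1 h
  have hyr' : y < r := by
    have := (ENNReal.ofReal_lt_iff_lt_toReal hy ENNReal.coe_ne_top).1 hyr
    simpa using this
  obtain ⟨ρ, hyρ, hρr⟩ := exists_between hyr'
  have hρ0 : 0 < ρ := hy.trans_lt hyρ
  have hr0 : (0 : ℝ) < r := hρ0.trans hρr
  obtain ⟨C, hC, hbound⟩ := p.norm_mul_pow_le_of_lt_radius hr
  have hsum : Summable fun n : ℕ => |p.coeff n| * (n * ρ ^ (n - 1)) := by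
    have hq : ‖ρ / r‖ < 1 := by
      rw [Real.norm_of_nonneg (div_nonneg hρ0.le hr0.le)]
      exact (div_lt_one hr0).2 hρr
    have hg : Summable fun n : ℕ => C / ρ * ((n : ℝ) ^ 1 * (ρ / r) ^ n) :=
      (summable_pow_mul_geometric_of_norm_lt_one 1 hq).mul_left _
    refine Summable.of_nonneg_of_le (fun n => by positivity) (fun n => ?_) hg
    rcases n with _ | n
    · simp
    · have hb := hbound (n + 1)
      rw [FormalMultilinearSeries.norm_apply_eq_norm_coef, Real.norm_eq_abs] at hb
      have hb' : |p.coeff (n + 1)| ≤ C / (r : ℝ) ^ (n + 1) := by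
        rwa [le_div_iff₀ (by positivity)]
      have hpos : (0 : ℝ) ≤ ((n + 1 : ℕ) : ℝ) * ρ ^ n :=
        mul_nonneg (Nat.cast_nonneg _) (pow_nonneg hρ0.le _)
      rw [Nat.add_sub_cancel]
      refine (mul_le_mul_of_nonneg_right hb' hpos).trans_eq ?_
      rw [div_pow, pow_succ ρ, pow_one]
      generalize ((n + 1 : ℕ) : ℝ) = m
      have := hρ0.ne'
      have := hr0.ne'
      field_simp
  have hle : ∀ (n : ℕ) (z : ℝ), z ∈ Set.Ioo (-ρ) ρ →
      ‖|p.coeff n| * (n * z ^ (n - 1))‖ ≤ |p.coeff n| * (n * ρ ^ (n - 1)) := fun n z hz => by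
    rw [norm_mul, norm_mul, norm_pow, Real.norm_eq_abs, abs_abs, Real.norm_natCast]
    gcongr
    exact abs_le.2 ⟨hz.1.le, hz.2.le⟩
  have hmem : y ∈ Set.Ioo (-ρ) ρ := ⟨by linarith, hyρ⟩
  have hd := hasDerivAt_tsum_of_isPreconnected (g := fun n z => |p.coeff n| * z ^ n)
    (g' := fun n z => |p.coeff n| * (n * z ^ (n - 1))) hsum isOpen_Ioo isPreconnected_Ioo
    (fun n z _ => (hasDerivAt_pow n z).const_mul _) hle hmem (summable_univariateAux hy h) hmem
  have hd' : deriv (univariateAux p) y = ∑' n : ℕ, |p.coeff n| * (n * y ^ (n - 1)) := hd.deriv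
  rw [hd']
  exact (Summable.of_norm_bounded hsum fun n => hle n y hmem).hasSum

namespace MultiSeries

variable {d : ℕ} {P : MultiSeries d}

theorem auxCoeff_nonneg (k : ℕ) : 0 ≤ P.auxCoeff k :=
  tsum_nonneg fun _ => mul_nonneg (abs_nonneg _) (Finset.prod_nonneg fun _ _ => norm_nonneg _)

theorem aux_zero : P.aux 0 = P.auxCoeff 0 := by
  rw [aux, tsum_eq_single 0 fun k hk => by simp [hk]]
  simp

theorem aux_one : P.aux 1 = ∑' k, P.auxCoeff k := by
  simp [aux]

/-- The point 1 may be on the boundary of convergence. The slope of y^k towards 1 is the geometric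
sum Σ_{j<k} y^j ≤ k, so dominated convergence applies. -/
theorem ConvergesAtOne.derivWithin_aux (hc : P.ConvergesAtOne) :
    derivWithin P.aux (Set.Icc 0 1) 1 = ∑' k : ℕ, (k : ℝ) * P.auxCoeff k := by
  refine HasDerivWithinAt.derivWithin ?_ (uniqueDiffOn_Icc zero_lt_one 1 (by simp))
  rw [hasDerivWithinAt_iff_tendsto_slope]
  have hterm : ∀ (k : ℕ) (y : ℝ), y ∈ Set.Icc (0 : ℝ) 1 \ {1} →
      ‖(∑ j ∈ Finset.range k, y ^ j) * P.auxCoeff k‖ ≤ k * P.auxCoeff k := fun k y hy => by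
    rw [norm_mul, Real.norm_of_nonneg (auxCoeff_nonneg k)]
    refine mul_le_mul_of_nonneg_right ?_ (auxCoeff_nonneg k)
    refine (norm_sum_le _ _).trans ((Finset.sum_le_card_nsmul _ _ 1 fun j _ => ?_).trans_eq
      (by simp))
    rw [norm_pow, Real.norm_of_nonneg hy.1.1]
    exact pow_le_one₀ hy.1.1 hy.1.2
  have hlim : Filter.Tendsto (fun y : ℝ => ∑' k, (∑ j ∈ Finset.range k, y ^ j) * P.auxCoeff k)
      (nhdsWithin 1 (Set.Icc 0 1 \ {1})) (nhds (∑' k : ℕ, (k : ℝ) * P.auxCoeff k)) := by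
    refine tendsto_tsum_of_dominated_convergence hc.aux_deriv (fun k => ?_) ?_
    · have hcont : Continuous fun y : ℝ => (∑ j ∈ Finset.range k, y ^ j) * P.auxCoeff k := by
        fun_prop
      have := (hcont.tendsto 1).mono_left (nhdsWithin_le_nhds (s := Set.Icc 0 1 \ {1}))
      simpa using this
    · filter_upwards [self_mem_nhdsWithin] with y hy k
      exact hterm k y hy
  refine hlim.congr' ?_
  filter_upwards [self_mem_nhdsWithin] with y hy
  have hy1 : y - 1 ≠ 0 := sub_ne_zero.2 hy.2
  have hs : Summable fun k => P.auxCoeff k * y ^ k :=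
    Summable.of_norm_bounded hc.aux fun k => by
      rw [norm_mul, norm_pow, Real.norm_of_nonneg (auxCoeff_nonneg k), Real.norm_of_nonneg hy.1.1]
      exact mul_le_of_le_one_right (auxCoeff_nonneg k) (pow_le_one₀ hy.1.1 hy.1.2)
  rw [slope_def_field, aux_one, MultiSeries.aux, ← hs.tsum_sub hc.aux, ← tsum_div_const]
  refine tsum_congr fun k => ?_
  rw [geom_sum_eq (sub_ne_zero.1 hy1)]
  field_simp

end MultiSeries

end AuxiliaryDerivatives

/-! ### The chain rule -/

theorem mainTheorem4 (b : ℕ → ℝ) (hb : SlowlyDecaying b) (B : ℝ) :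
    ∃ C : ℝ, 0 < C ∧ ∀ (L : ℝ → ℝ → ℝ), IsLoss B L →
      ∀ (d : ℕ) (h : UnitSphere d → ℝ) (P : MultiSeries d), P.Represents h → P.ConvergesAtOne →
      ∀ (g : ℝ → ℝ) (p : FormalMultilinearSeries ℝ ℝ ℝ),
        HasFPowerSeriesOnBall g p 0 p.radius →
        ENNReal.ofReal (P.aux 0) < p.radius → ENNReal.ofReal (P.aux 1) < p.radius →
        ∃ M : ℝ, 0 ≤ M ∧
          √M = deriv (univariateAux p) (P.aux 1) * derivWithin P.aux (Set.Icc 0 1) 1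
            + univariateAux p (P.aux 0) ∧
          EfficientlyLearnedWith (kernelRegression (dotKernel b)) L C (g ∘ h) M := by
  obtain ⟨c, hc, hbc⟩ := hb.2
  have hb0 : 0 ≤ ∑' k, b k := tsum_nonneg fun k => (hb.pos k).le
  -- The RKHS norm is at most 2√M / √c, the kernel is bounded by Σ b_k, and |B| + 1 is a positive
  -- loss bound whatever the sign of B.
  refine ⟨2 * (4 * ((√c)⁻¹ * 2) * √(∑' k, b k) + (|B| + 1) + 1) ^ 2, by positivity, ?_⟩
  intro L hL d h P hP hconv g p hg h0 h1
  have hexp := MultiSeries.hasExpansion hP hconv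
  rw [← hconv.derivWithin_aux, ← MultiSeries.aux_one] at hexp
  set y := P.aux 1 with hy
  set y₀ := P.aux 0 with hy₀
  set D := derivWithin P.aux (Set.Icc 0 1) 1 with hD
  have hy₀0 : 0 ≤ y₀ := by rw [hy₀, MultiSeries.aux_zero]; exact MultiSeries.auxCoeff_nonneg 0
  have hD0 : 0 ≤ D := by
    rw [hD, hconv.derivWithin_aux]
    exact tsum_nonneg fun k => mul_nonneg (Nat.cast_nonneg _) (MultiSeries.auxCoeff_nonneg k)
  have hyy : y₀ ≤ y := by
    rw [hy₀, hy, MultiSeries.aux_zero, MultiSeries.aux_one]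
    exact hconv.aux.le_tsum 0 fun k _ => MultiSeries.auxCoeff_nonneg k
  -- The constant term cancels, and every other degree is at least 1.
  have hyD : y - y₀ ≤ D := by
    rw [hy₀, hy, hD, hconv.derivWithin_aux, MultiSeries.aux_zero, MultiSeries.aux_one,
      hconv.aux.tsum_eq_zero_add, hconv.aux_deriv.tsum_eq_zero_add, add_sub_cancel_left]
    simp only [Nat.cast_zero, zero_mul, zero_add]
    refine ((summable_nat_add_iff 1).2 hconv.aux).tsum_le_tsum (fun k => ?_)
      ((summable_nat_add_iff 1).2 hconv.aux_deriv)
    refine le_mul_of_one_le_left (MultiSeries.auxCoeff_nonneg _) ?_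
    push_cast
    linarith [Nat.cast_nonneg (α := ℝ) k]
  have hyn : 0 ≤ y := hy₀0.trans hyy
  have hs := (summable_univariateAux hyn h1).hasSum
  have hs₀ := (summable_univariateAux hy₀0 h0).hasSum
  have hds := hasDerivAt_univariateAux hyn h1
  have hd0 : 0 ≤ deriv (univariateAux p) y := hds.nonneg fun n => by positivity
  have hu0 : 0 ≤ univariateAux p y₀ := hs₀.nonneg fun n => by positivity
  -- Mean value estimate, term by term: yⁿ − y₀ⁿ ≤ n yⁿ⁻¹ (y − y₀). It trades g̃(h̃(1)) for
  -- g̃(h̃(0)).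
  have hu : univariateAux p y ≤ univariateAux p y₀ + deriv (univariateAux p) y * D := by
    refine hasSum_le (fun n => ?_) hs (hs₀.add (hds.mul_right D))
    have hpow : y ^ n - y₀ ^ n ≤ n * y ^ (n - 1) * D := by
      have hp := abs_pow_sub_pow_le (a := y) (b := y₀) (n := n)
      rw [abs_of_nonneg hyn, abs_of_nonneg hy₀0, max_eq_left hyy,
        abs_of_nonneg (sub_nonneg.2 hyy)] at hp
      calc y ^ n - y₀ ^ n ≤ (y - y₀) * n * y ^ (n - 1) := (le_abs_self _).trans hp
        _ ≤ D * n * y ^ (n - 1) := by gcongr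
        _ = _ := by ring
    nlinarith [mul_le_mul_of_nonneg_left hpow (abs_nonneg (p.coeff n))]
  set S := deriv (univariateAux p) y * D + univariateAux p y₀ with hS
  have hS0 : 0 ≤ S := by positivity
  refine ⟨S ^ 2, sq_nonneg S, Real.sqrt_sq hS0, ?_⟩
  have hcomp : HasExpansion (g ∘ h) (univariateAux p y) (deriv (univariateAux p) y * D) := by
    refine hasExpansion_of_hasSum (u := fun n x => p.coeff n * h x ^ n)
      (fun n => (hasExpansion_const (p.coeff n)).mul (hexp.pow n)) hs ?_ fun x => ?_
    · refine (hds.mul_right D).congr_fun fun n => ?_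
      ring
    -- On the sphere |h| ≤ h̃(1), so the power series of g applies to all values of h.
    · have hx : h x ∈ Metric.eball (0 : ℝ) p.radius := by
        rw [Metric.mem_eball, edist_zero_right, ← ofReal_norm, Real.norm_eq_abs]
        exact (ENNReal.ofReal_le_ofReal (hexp.abs_le x)).trans_lt h1
      have := hg.hasSum hx
      simpa [FormalMultilinearSeries.apply_eq_prod_smul_coeff, mul_comm] using this
  refine InKernelBall.efficientlyLearnedWith hL (B' := |B| + 1) (by linarith [le_abs_self B])
    (by positivity) hb.isPosSemidefKernel dotKernel_comm hb.continuous_dotKernel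
    (Real.sqrt_nonneg _) (fun x x' => by rw [Real.sq_sqrt hb0]; exact hb.abs_dotKernel_le x x')
    (c := (√c)⁻¹ * 2) (by positivity) (sq_nonneg S) ?_ le_rfl
  refine (hb.inKernelBall_of_hasExpansion hc hbc hcomp).mono ?_
  rw [Real.sqrt_sq hS0, mul_assoc]
  refine mul_le_mul_of_nonneg_left ?_ (by positivity)
  linarith
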